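/- All graphs are finite and simple. A cycle of a graph is chordless if the graph has no edge, other than the edges of the cycle, joining two vertices of the cycle; a graph is $\ell$-chordal if it has no chordless cycle of length greater than $\ell$. A subdivision of a graph $H$ in a graph $G$ consists of an injective map $\eta : V(H) \to V(G)$ and, for every edge $xy \in E(H)$, an $\eta(x)$-$\eta(y)$-path $P^{xy} \subseteq G$, such that the paths $P^{xy}$ are pairwise internally disjoint and none of them has an internal vertex in $\eta(V(H))$. It is a $(\le r)$-subdivision if every path $P^{xy}$ has length at most $r$. For all integers $\ell \ge 0$ and $s \ge 0$ there exists a real number $q > 0$ such that the following holds. Let $m, r$ be positive integers with $m \ge qr$. Then every $\ell$-chordal graph that contains a $(\le r)$-subdivision of the complete graph $K_m$ contains the complete bipartite graph $K_{s,s}$ as a (not necessarily induced) subgraph. -/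

import Mathlib

namespace SimpleGraph

universe u v

/-- A graph is `ℓ`-chordal if it has no chordless cycle of length greater than `ℓ`. -/
def IsEllChordal {V : Type u} (G : SimpleGraph V) (ℓ : ℕ) : Prop :=
  ∀ ⦃a : V⦄ (c : G.Walk a a), c.IsCycle → c.IsChordless → c.length ≤ ℓ

/-- The internal vertices of a walk from `a` to `b` (meant for paths): its vertices other than
its ends. -/
def Walk.internalVertices {V : Type u} {G : SimpleGraph V} {a b : V} (p : G.Walk a b) : Set V :=
  {v | v ∈ p.support ∧ v ≠ a ∧ v ≠ b}

/-- A subdivision of `H` in `G`: an injective choice of branch vertices and, for every edge of `H`,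
a path in `G` between the corresponding branch vertices, such that the paths are internally
disjoint and have no internal vertex among the branch vertices. The paths are indexed by the
oriented edges of `H`; the two orientations of an edge carry the same path, reversed. -/
structure Subdivision {W : Type v} {V : Type u} (H : SimpleGraph W) (G : SimpleGraph V) where
  /-- the branch vertices -/
  branch : W ↪ V
  /-- the path that replaces an edge of `H` -/
  path : ∀ {x y : W}, H.Adj x y → G.Walk (branch x) (branch y)
  isPath : ∀ {x y : W} (h : H.Adj x y), (path h).IsPath
  path_symm : ∀ {x y : W} (h : H.Adj x y), path h.symm = (path h).reverse
  internally_disjoint : ∀ {x y x' y' : W} (h : H.Adj x y) (h' : H.Adj x' y'),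
    s(x, y) ≠ s(x', y') → Disjoint (path h).internalVertices (path h').internalVertices
  branch_notMem_internal : ∀ {x y : W} (h : H.Adj x y) (z : W),
    branch z ∉ (path h).internalVertices

/-- `G` contains a `(≤ r)`-subdivision of `H`: one all of whose paths have length at most `r`. -/
def ContainsSubdivisionLE {W : Type v} {V : Type u} (H : SimpleGraph W) (G : SimpleGraph V)
    (r : ℕ) : Prop :=
  ∃ S : Subdivision H G, ∀ (x y : W) (h : H.Adj x y), (S.path h).length ≤ r

end SimpleGraph

/-!
The proof rests on the degeneracy bound `exists_not_hasCore`, the case of long cycles of a theorem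
of Kühn and Osthus: an `ℓ`-chordal graph without `K_{s,s}` contains no subgraph of minimum degree
`D(ℓ, s)`. Given this bound, the `O(m² r)` vertices of a `(≤ r)`-subdivision of `K_m` induce only
`O(m² r)` edges. Every edge that joins an internal vertex of a path `P^{xy}` to a vertex outside
this path spoils a triple of branch vertices, and it spoils only boundedly many of them. When
`m / r` is large, the bad triples are a small fraction of all `m³` triples. A random bounded set of
branch vertices therefore contains no bad triple (`exists_avoiding_triples`), and by greedy
colouring a large part of it is independent. Following the paths between consecutive ones of these
branch vertices, and returning along the path from the last to the first, gives a long chordless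
cycle (`Subdivision.false_of_forall_notMem_badTriples`). The paths may have chords of their own:
shortest walks are taken in the induced subgraphs (`IsEllChordal.exists_short_walk`), and the cycle
stays long because the position along the sequence of branch vertices changes by at most one along
each edge.

For the degeneracy bound, a dense graph is replaced `k` times by a dense part of a breadth-first
search layer in it, or of two consecutive layers with the lower one independent
(`exists_dense_layer`). A long induced path is found in what remains
(`exists_isInducedPath_of_hasCore`, by growing a path in the style of Gyárfás). For each of the `k`
searches, the vertices of the path, or at least one of any two consecutive ones, have neighbours in
the layer `R` above, and the vertices of `R` are connected to each other through still higher
layers, away from the path. A long gap between neighbours of `R` on the path would close up to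
a long chordless cycle, so one vertex of `R` has neighbours in all short windows of a long subpath
(`IsInducedPath.exists_frequent_neighbor`). The resulting `k` vertices and the path contain
a `K_{s,s}` by the pigeonhole principle.
-/

namespace SimpleGraph

universe u

open scoped Classical

/-! ### Chordless cycles from two short connections -/

section Holes

variable {V : Type u} {G : SimpleGraph V}

/-- A shortest walk inside the support of a given walk is a chordless path. -/
theorem Walk.exists_isPath_isChordless {x y : V} (w : G.Walk x y) :
    ∃ p : G.Walk x y, p.IsPath ∧ p.IsChordless ∧ ∀ v ∈ p.support, v ∈ w.support := by
  obtain ⟨p₀, hp₀, hmin⟩ := WellFounded.has_min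
    (measure (fun p : G.Walk x y => p.length)).wf {p | ∀ v ∈ p.support, v ∈ w.support}
    ⟨w, fun v hv => hv⟩
  obtain ⟨p, hpath, hp, hlen⟩ : ∃ p : G.Walk x y, p.IsPath ∧ (∀ v ∈ p.support, v ∈ w.support) ∧
      p.length ≤ p₀.length :=
    ⟨p₀.bypass, p₀.bypass_isPath, fun v hv => hp₀ v (p₀.support_bypass_subset_support hv),
      p₀.length_bypass_le_length⟩
  have key : ∀ q : G.Walk x y, (∀ v ∈ q.support, v ∈ w.support) → p.length ≤ q.length :=
    fun q hq => hlen.trans (not_lt.mp (hmin q hq))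
  refine ⟨p, hpath, ?_, hp⟩
  have main : ∀ i j, i < j → j ≤ p.length → G.Adj (p.getVert i) (p.getVert j) → j = i + 1 := by
    intro i j hij hj hadj
    by_contra hne
    have := key ((p.take i).append (Walk.cons hadj (p.drop j))) (by
      intro v hv
      simp only [Walk.mem_support_append_iff, Walk.support_cons, List.mem_cons] at hv
      rcases hv with hv | rfl | hv
      · exact hp _ ((p.isSubwalk_take i).support_subset hv)
      · exact hp _ (p.getVert_mem_support i)
      · exact hp _ ((p.isSubwalk_drop j).support_subset hv))
    simp only [Walk.length_append, Walk.length_cons, Walk.take_length, Walk.drop_length] at this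
    omega
  rw [Walk.isChordless_iff_forall_mem_edges]
  intro a b ha hb hab
  obtain ⟨i, rfl, hi⟩ := Walk.mem_support_iff_exists_getVert.mp ha
  obtain ⟨j, rfl, hj⟩ := Walk.mem_support_iff_exists_getVert.mp hb
  have edge : ∀ i, i + 1 ≤ p.length → s(p.getVert i, p.getVert (i + 1)) ∈ p.edges := by
    intro i hi
    exact p.mk_mem_edges_iff_exists.mpr ⟨i, by omega, rfl⟩
  rcases lt_trichotomy i j with h | h | h
  · obtain rfl := main i j h hj hab
    exact edge i hj
  · subst h; exact absurd hab (G.loopless.irrefl _)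
  · obtain rfl := main j i h hi hab.symm
    rw [Sym2.eq_swap]; exact edge j hi

/-- A walk is at least as long as the variation, along it, of a function that changes by at most
one along each edge. -/
theorem Walk.le_add_length_of_lipschitz (S : Set V) (g : V → ℕ)
    (hg : ∀ a ∈ S, ∀ b ∈ S, G.Adj a b → g b ≤ g a + 1) {x y : V} (w : G.Walk x y)
    (hw : ∀ v ∈ w.support, v ∈ S) : g y ≤ g x + w.length := by
  induction w with
  | nil => simp
  | cons h p ih =>
    simp only [Walk.support_cons, List.mem_cons, forall_eq_or_imp] at hw
    have h1 := ih hw.2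
    have h2 := hg _ hw.1 _ (hw.2 _ p.start_mem_support) h
    rw [Walk.length_cons]; omega

/-- In an `ℓ`-chordal graph, two non-adjacent vertices that are connected through each of two
disjoint, mutually non-adjacent sets `A` and `B` are connected by a short walk through `A`:
chordless paths through `A` and through `B` together form a chordless cycle. -/
theorem IsEllChordal.exists_short_walk {ℓ : ℕ} (hG : G.IsEllChordal ℓ) {x y : V} (hxy : x ≠ y)
    (hadj : ¬ G.Adj x y) {A B : Set V} (hd : Disjoint A B) (hAB : ∀ a ∈ A, ∀ b ∈ B, ¬ G.Adj a b)
    (p : G.Walk x y) (hp : ∀ v ∈ p.support, v = x ∨ v = y ∨ v ∈ A)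
    (q : G.Walk x y) (hq : ∀ v ∈ q.support, v = x ∨ v = y ∨ v ∈ B) :
    ∃ w : G.Walk x y, (∀ v ∈ w.support, v = x ∨ v = y ∨ v ∈ A) ∧ w.length + 2 ≤ ℓ := by
  obtain ⟨p', hp1, hp2, hp3⟩ := p.exists_isPath_isChordless
  obtain ⟨q', hq1, hq2, hq3⟩ := q.reverse.exists_isPath_isChordless
  have hpA : ∀ v ∈ p'.support, v = x ∨ v = y ∨ v ∈ A := fun v hv => hp v (hp3 v hv)
  have hqB : ∀ v ∈ q'.support, v = x ∨ v = y ∨ v ∈ B := fun v hv =>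
    hq v (by simpa using hq3 v hv)
  have len : ∀ {a b : V} (w : G.Walk a b), a ≠ b → ¬ G.Adj a b → 2 ≤ w.length := by
    intro a b w hne hna
    by_contra hlt
    have : w.length = 0 ∨ w.length = 1 := by omega
    rcases this with h | h
    · exact hne (Walk.eq_of_length_eq_zero h)
    · exact hna (Walk.adj_of_length_eq_one h)
  have hlp := len p' hxy hadj
  have hlq := len q' hxy.symm fun h => hadj h.symm
  have hcyc : (p'.append q').IsCycle := by
    refine hp1.isCycle_append hq1 ?_ (Or.inl hlp)
    have hxp : x ∉ p'.support.tail := by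
      have := hp1.support_nodup
      rw [← Walk.cons_tail_support] at this
      exact (List.nodup_cons.mp this).1
    have hyq : y ∉ q'.support.tail := by
      have := hq1.support_nodup
      rw [← Walk.cons_tail_support] at this
      exact (List.nodup_cons.mp this).1
    intro v hvp hvq
    rcases hpA v (List.mem_of_mem_tail hvp) with rfl | rfl | hA
    · exact hxp hvp
    · exact hyq hvq
    · rcases hqB v (List.mem_of_mem_tail hvq) with rfl | rfl | hB
      · exact hxp hvp
      · exact hyq hvq
      · exact Set.disjoint_left.mp hd hA hB
  have hchord : (p'.append q').IsChordless := by
    rw [Walk.isChordless_iff_forall_mem_edges]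
    intro a b ha hb hab
    rw [Walk.edges_append, List.mem_append]
    rw [Walk.mem_support_append_iff] at ha hb
    have mixed : ∀ a b, a ∈ p'.support → b ∈ q'.support → G.Adj a b →
        s(a, b) ∈ p'.edges ∨ s(a, b) ∈ q'.edges := by
      intro a b ha hb hab
      rcases hqB b hb with rfl | rfl | hB
      · exact Or.inl (hp2.mem_edges ha (Walk.start_mem_support _) hab)
      · exact Or.inl (hp2.mem_edges ha (Walk.end_mem_support _) hab)
      · rcases hpA a ha with rfl | rfl | hA
        · exact Or.inr (hq2.mem_edges (Walk.end_mem_support _) hb hab)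
        · exact Or.inr (hq2.mem_edges (Walk.start_mem_support _) hb hab)
        · exact absurd hab (hAB a hA b hB)
    rcases ha with ha | ha <;> rcases hb with hb | hb
    · exact Or.inl (hp2.mem_edges ha hb hab)
    · exact mixed a b ha hb hab
    · rw [Sym2.eq_swap]; exact mixed b a hb ha hab.symm
    · exact Or.inr (hq2.mem_edges ha hb hab)
  have := hG _ hcyc hchord
  rw [Walk.length_append] at this
  exact ⟨p', hpA, by omega⟩

end Holes

/-! ### Degeneracy -/

section Cores

variable {V : Type u} {G : SimpleGraph V}

/-- `X` and `Y` contain a non-empty core `X', Y'` in which every vertex of either set has at least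
`d` neighbours in the other one. The sets may overlap; for `X = Y` this says that some subgraph
induced on a subset of `X` has minimum degree at least `d`. -/
def HasCore (G : SimpleGraph V) (d : ℕ) (X Y : Finset V) : Prop :=
  ∃ X' ⊆ X, ∃ Y' ⊆ Y, X'.Nonempty ∧ (∀ x ∈ X', d ≤ (Y'.filter (G.Adj x)).card) ∧
    ∀ y ∈ Y', d ≤ (X'.filter (G.Adj y)).card

/-- The edges between `X` and `Y` are distributed among their ends, via `F`, so that each vertex
receives at most `d` of them: `x ∈ X` receives the edges with `F x y`, and `y ∈ Y` the others. -/
def EdgesSplit (G : SimpleGraph V) (d : ℕ) (X Y : Finset V) : Prop :=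
  ∃ F : V → V → Prop, (∀ x ∈ X, (Y.filter fun y => G.Adj x y ∧ F x y).card ≤ d) ∧
    ∀ y ∈ Y, (X.filter fun x => G.Adj y x ∧ ¬ F x y).card ≤ d

theorem HasCore.mono {d d' : ℕ} {X X' Y Y' : Finset V} (h : G.HasCore d X Y) (hd : d' ≤ d)
    (hX : X ⊆ X') (hY : Y ⊆ Y') : G.HasCore d' X' Y' := by
  obtain ⟨A, hA, B, hB, hne, h1, h2⟩ := h
  exact ⟨A, hA.trans hX, B, hB.trans hY, hne, fun x hx => hd.trans (h1 x hx),
    fun y hy => hd.trans (h2 y hy)⟩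

theorem HasCore.union {d : ℕ} {X Y : Finset V} (h : G.HasCore d X Y) :
    G.HasCore d (X ∪ Y) (X ∪ Y) := by
  obtain ⟨A, hA, B, hB, hne, h1, h2⟩ := h
  have key : ∀ x ∈ A ∪ B, d ≤ ((A ∪ B).filter (G.Adj x)).card := by
    intro x hx
    rcases Finset.mem_union.mp hx with hx | hx
    · exact (h1 x hx).trans
        (Finset.card_le_card (Finset.filter_subset_filter _ Finset.subset_union_right))
    · exact (h2 x hx).trans
        (Finset.card_le_card (Finset.filter_subset_filter _ Finset.subset_union_left))
  exact ⟨A ∪ B, Finset.union_subset_union hA hB, A ∪ B, Finset.union_subset_union hA hB,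
    hne.mono Finset.subset_union_left, key, key⟩

theorem HasCore.le_card {d : ℕ} {X Y : Finset V} (hd : 0 < d) (h : G.HasCore d X Y) :
    d ≤ X.card ∧ d ≤ Y.card := by
  obtain ⟨A, hA, B, hB, ⟨x, hx⟩, h1, h2⟩ := h
  have h3 := h1 x hx
  obtain ⟨y, hy⟩ := Finset.card_pos.mp (hd.trans_le h3)
  have h4 := h2 y (Finset.mem_filter.mp hy).1
  exact ⟨h4.trans (Finset.card_le_card ((Finset.filter_subset _ _).trans hA)),
    h3.trans (Finset.card_le_card ((Finset.filter_subset _ _).trans hB))⟩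

theorem edgesSplit_of_not_hasCore {d : ℕ} {X Y : Finset V} (h : ¬ G.HasCore (d + 1) X Y) :
    G.EdgesSplit d X Y := by
  induction hn : X.card + Y.card using Nat.strong_induction_on generalizing X Y with
  | _ n ih =>
  rcases X.eq_empty_or_nonempty with rfl | hne
  · exact ⟨fun _ _ => True, by simp, by simp⟩
  have : (∃ x ∈ X, (Y.filter (G.Adj x)).card ≤ d) ∨ ∃ y ∈ Y, (X.filter (G.Adj y)).card ≤ d := by
    by_contra hcon
    push Not at hcon
    exact h ⟨X, subset_rfl, Y, subset_rfl, hne, fun x hx => hcon.1 x hx, fun y hy => hcon.2 y hy⟩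
  rcases this with ⟨x, hx, hxd⟩ | ⟨y, hy, hyd⟩
  · have hlt : (X.erase x).card + Y.card < n := by
      have := Finset.card_erase_lt_of_mem hx
      omega
    obtain ⟨F, hF1, hF2⟩ := ih _ hlt
      (fun hc => h (hc.mono le_rfl (Finset.erase_subset _ _) subset_rfl)) rfl
    refine ⟨fun a b => a = x ∨ F a b, fun a ha => ?_, fun b hb => ?_⟩
    · by_cases hax : a = x
      · subst hax
        refine (Finset.card_le_card fun b hb => ?_).trans hxd
        simp only [Finset.mem_filter] at hb ⊢
        exact ⟨hb.1, hb.2.1⟩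
      · simpa [hax] using hF1 a (Finset.mem_erase.mpr ⟨hax, ha⟩)
    · refine (Finset.card_le_card fun a ha => ?_).trans (hF2 b hb)
      simp only [Finset.mem_filter, Finset.mem_erase, not_or] at ha ⊢
      exact ⟨⟨ha.2.2.1, ha.1⟩, ha.2.1, ha.2.2.2⟩
  · have hlt : X.card + (Y.erase y).card < n := by
      have := Finset.card_erase_lt_of_mem hy
      omega
    obtain ⟨F, hF1, hF2⟩ := ih _ hlt
      (fun hc => h (hc.mono le_rfl subset_rfl (Finset.erase_subset _ _))) rfl
    refine ⟨fun a b => b ≠ y ∧ F a b, fun a ha => ?_, fun b hb => ?_⟩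
    · refine (Finset.card_le_card fun b hb => ?_).trans (hF1 a ha)
      simp only [Finset.mem_filter, Finset.mem_erase] at hb ⊢
      exact ⟨⟨hb.2.2.1, hb.1⟩, hb.2.1, hb.2.2.2⟩
    · by_cases hby : b = y
      · subst hby
        refine (Finset.card_le_card fun a ha => ?_).trans hyd
        simp only [Finset.mem_filter] at ha ⊢
        exact ⟨ha.1, ha.2.1⟩
      · simpa [hby] using hF2 b (Finset.mem_erase.mpr ⟨hby, hb⟩)

theorem EdgesSplit.mono {d : ℕ} {X X' Y Y' : Finset V} (h : G.EdgesSplit d X Y)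
    (hX : X' ⊆ X) (hY : Y' ⊆ Y) : G.EdgesSplit d X' Y' := by
  obtain ⟨F, h1, h2⟩ := h
  exact ⟨F,
    fun x hx => (Finset.card_le_card (Finset.filter_subset_filter _ hY)).trans (h1 x (hX hx)),
    fun y hy => (Finset.card_le_card (Finset.filter_subset_filter _ hX)).trans (h2 y (hY hy))⟩

/-- Each edge is received by one of its ends, so there are at most `d (|X| + |Y|)` of them. -/
theorem EdgesSplit.sum_card_le {d : ℕ} {X Y : Finset V} (h : G.EdgesSplit d X Y) :
    ∑ x ∈ X, (Y.filter (G.Adj x)).card ≤ d * (X.card + Y.card) := by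
  obtain ⟨F, h1, h2⟩ := h
  have e1 : ∀ x, (Y.filter (G.Adj x)).card =
      (Y.filter fun y => G.Adj x y ∧ F x y).card +
        (Y.filter fun y => G.Adj y x ∧ ¬ F x y).card := by
    intro x
    rw [← Finset.card_filter_add_card_filter_not (s := Y.filter (G.Adj x)) (F x),
      Finset.filter_filter, Finset.filter_filter]
    simp only [G.adj_comm x]
  have e2 : ∑ x ∈ X, (Y.filter fun y => G.Adj y x ∧ ¬ F x y).card =
      ∑ y ∈ Y, (X.filter fun x => G.Adj y x ∧ ¬ F x y).card :=
    Finset.sum_card_bipartiteAbove_eq_sum_card_bipartiteBelow (fun x y => G.Adj y x ∧ ¬ F x y)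
  rw [Finset.sum_congr rfl fun x _ => e1 x, Finset.sum_add_distrib, e2]
  have b1 := Finset.sum_le_card_nsmul X _ d h1
  have b2 := Finset.sum_le_card_nsmul Y _ d h2
  simp only [smul_eq_mul] at b1 b2
  nlinarith

theorem EdgesSplit.not_hasCore {d : ℕ} {X Y : Finset V} (h : G.EdgesSplit d X Y) :
    ¬ G.HasCore (2 * d + 1) X Y := by
  rintro ⟨A, hA, B, hB, hne, h1, h2⟩
  have hs := (h.mono hA hB).sum_card_le
  have e : ∑ x ∈ A, (B.filter (G.Adj x)).card = ∑ y ∈ B, (A.filter (G.Adj y)).card := by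
    have := Finset.sum_card_bipartiteAbove_eq_sum_card_bipartiteBelow (s := A) (t := B) G.Adj
    simpa only [Finset.bipartiteAbove, Finset.bipartiteBelow, G.adj_comm] using this
  have b1 := Finset.card_nsmul_le_sum A _ _ h1
  have b2 := Finset.card_nsmul_le_sum B _ _ h2
  have := hne.card_pos
  rw [← e] at b2
  simp only [smul_eq_mul] at b1 b2
  nlinarith

/-- Greedy colouring. -/
theorem exists_coloring_of_not_hasCore {d : ℕ} {S : Finset V} (h : ¬ G.HasCore (d + 1) S S) :
    ∃ c : V → Fin (d + 1), ∀ a ∈ S, ∀ b ∈ S, G.Adj a b → c a ≠ c b := by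
  induction hn : S.card using Nat.strong_induction_on generalizing S with
  | _ n ih =>
  rcases S.eq_empty_or_nonempty with rfl | hne
  · exact ⟨fun _ => 0, by simp⟩
  obtain ⟨v, hv, hvd⟩ : ∃ v ∈ S, (S.filter (G.Adj v)).card ≤ d := by
    by_contra hcon
    push Not at hcon
    exact h ⟨S, subset_rfl, S, subset_rfl, hne, hcon, hcon⟩
  obtain ⟨c, hc⟩ := ih (S.erase v).card (hn ▸ Finset.card_erase_lt_of_mem hv)
    (fun hc => h (hc.mono le_rfl (Finset.erase_subset _ _) (Finset.erase_subset _ _))) rfl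
  obtain ⟨k, hk⟩ : ∃ k, k ∉ (S.filter (G.Adj v)).image c := by
    by_contra hcon
    push Not at hcon
    have h1 : (Finset.univ : Finset (Fin (d + 1))).card ≤ ((S.filter (G.Adj v)).image c).card :=
      Finset.card_le_card fun k _ => hcon k
    have h2 := Finset.card_image_le (s := S.filter (G.Adj v)) (f := c)
    simp at h1
    omega
  have hk' : ∀ b ∈ S, G.Adj v b → c b ≠ k := fun b hb hvb hcb =>
    hk (Finset.mem_image.mpr ⟨b, Finset.mem_filter.mpr ⟨hb, hvb⟩, hcb⟩)
  refine ⟨Function.update c v k, fun a ha b hb hab => ?_⟩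
  by_cases hav : a = v
  · subst hav
    rw [Function.update_self, Function.update_of_ne hab.ne']
    exact (hk' b hb hab).symm
  · by_cases hbv : b = v
    · subst hbv
      rw [Function.update_self, Function.update_of_ne hav]
      exact hk' a ha hab.symm
    · rw [Function.update_of_ne hav, Function.update_of_ne hbv]
      exact hc a (Finset.mem_erase.mpr ⟨hav, ha⟩) b (Finset.mem_erase.mpr ⟨hbv, hb⟩) hab

end Cores

/-! ### Long induced paths -/

section InducedPaths

variable {V : Type u} {G : SimpleGraph V}

theorem completeBipartiteGraph_isContained_of_card_le {s : ℕ} {A B : Finset V} (hA : s ≤ A.card)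
    (hB : s ≤ B.card) (h : ∀ a ∈ A, ∀ b ∈ B, G.Adj a b) :
    (completeBipartiteGraph (Fin s) (Fin s)).IsContained G := by
  obtain ⟨A', hA', hcA⟩ := Finset.exists_subset_card_eq hA
  obtain ⟨B', hB', hcB⟩ := Finset.exists_subset_card_eq hB
  rw [completeBipartiteGraph_isContained_iff]
  exact ⟨A', B', by simpa using hcA, by simpa using hcB,
    fun _ ha _ hb => h _ (hA' ha) _ (hB' hb)⟩

/-- The first `N` terms of `p` are the vertices, in order, of an induced path of `G`. -/
structure IsInducedPath (G : SimpleGraph V) (N : ℕ) (p : ℕ → V) : Prop where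
  inj : ∀ i < N, ∀ j < N, p i = p j → i = j
  adj : ∀ i < N, ∀ j < N, (G.Adj (p i) (p j) ↔ i + 1 = j ∨ j + 1 = i)

/-- The set `C` induces a connected subgraph, in the form: every proper non-empty part of `C` is
joined to the rest of `C` by an edge. The empty set is allowed. -/
def ConnectedOn (G : SimpleGraph V) (C : Finset V) : Prop :=
  ∀ K ⊆ C, K.Nonempty → (C \ K).Nonempty → ∃ a ∈ K, ∃ b ∈ C \ K, G.Adj a b

theorem ConnectedOn.insert {C : Finset V} (hC : G.ConnectedOn C) {a b : V} (ha : a ∈ C)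
    (hab : G.Adj a b) : G.ConnectedOn (insert b C) := by
  intro K hK hne hne'
  by_cases h1 : (K ∩ C).Nonempty
  · by_cases h2 : (C \ (K ∩ C)).Nonempty
    · obtain ⟨x, hx, y, hy, hxy⟩ := hC _ Finset.inter_subset_right h1 h2
      refine ⟨x, (Finset.mem_inter.mp hx).1, y, ?_, hxy⟩
      simp only [Finset.mem_sdiff, Finset.mem_inter, Finset.mem_insert] at hy ⊢
      tauto
    · have hCK : C ⊆ K := fun x hx => by
        by_contra hxK
        exact h2 ⟨x, by simp [hx, hxK]⟩
      obtain ⟨y, hy⟩ := hne'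
      refine ⟨a, hCK ha, y, hy, ?_⟩
      simp only [Finset.mem_sdiff, Finset.mem_insert] at hy
      rcases hy with ⟨rfl | hy, hyK⟩
      · exact hab
      · exact absurd (hCK hy) hyK
  · have hKC : ∀ x ∈ K, x ∉ C := fun x hx hxC => h1 ⟨x, Finset.mem_inter.mpr ⟨hx, hxC⟩⟩
    obtain ⟨x, hx⟩ := hne
    refine ⟨x, hx, a, by simpa [ha] using fun haK => hKC a haK ha, ?_⟩
    rcases Finset.mem_insert.mp (hK hx) with rfl | hxC
    · exact hab.symm
    · exact absurd hxC (hKC x hx)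

theorem exists_component {C : Finset V} {x : V} (hx : x ∈ C) :
    ∃ K ⊆ C, x ∈ K ∧ G.ConnectedOn K ∧ ∀ a ∈ K, ∀ b ∈ C, G.Adj a b → b ∈ K := by
  obtain ⟨K, hK, hmin⟩ := Finset.exists_min_image
    (C.powerset.filter fun K => x ∈ K ∧ ∀ a ∈ K, ∀ b ∈ C, G.Adj a b → b ∈ K) Finset.card
    ⟨C, Finset.mem_filter.mpr
      ⟨Finset.mem_powerset.mpr subset_rfl, hx, fun _ _ _ hb _ => hb⟩⟩
  simp only [Finset.mem_filter, Finset.mem_powerset] at hK hmin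
  obtain ⟨hKC, hxK, hcl⟩ := hK
  refine ⟨K, hKC, hxK, fun L hL hne hne' => ?_, hcl⟩
  by_contra hcon
  push Not at hcon
  by_cases hxL : x ∈ L
  · have := hmin L ⟨hL.trans hKC, hxL, fun a ha b hb hab => by
      by_contra hbL
      exact hcon a ha b (Finset.mem_sdiff.mpr ⟨hcl a (hL ha) b hb hab, hbL⟩) hab⟩
    have h2 := Finset.card_sdiff_add_card_eq_card hL
    have := hne'.card_pos
    omega
  · have := hmin (K \ L) ⟨Finset.sdiff_subset.trans hKC, Finset.mem_sdiff.mpr ⟨hxK, hxL⟩,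
      fun a ha b hb hab => by
        refine Finset.mem_sdiff.mpr ⟨hcl a (Finset.mem_sdiff.mp ha).1 b hb hab, fun hbL => ?_⟩
        exact hcon b hbL a ha hab.symm⟩
    have h2 := Finset.card_sdiff_add_card_eq_card hL
    have := hne.card_pos
    omega

/-- A core survives in one connected component. -/
theorem HasCore.exists_component {d : ℕ} {X Y C : Finset V} (h : G.HasCore d X Y)
    (hX : X ⊆ C) (hY : Y ⊆ C) :
    ∃ K ⊆ C, K.Nonempty ∧ G.ConnectedOn K ∧ (∀ a ∈ K, ∀ b ∈ C, G.Adj a b → b ∈ K) ∧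
      G.HasCore d (X ∩ K) (Y ∩ K) := by
  obtain ⟨A, hA, B, hB, ⟨x, hx⟩, h1, h2⟩ := h
  obtain ⟨K, hKC, hxK, hK, hcl⟩ := SimpleGraph.exists_component (G := G) (hX (hA hx))
  refine ⟨K, hKC, ⟨x, hxK⟩, hK, hcl, A ∩ K, Finset.inter_subset_inter hA subset_rfl,
    B ∩ K, Finset.inter_subset_inter hB subset_rfl, ⟨x, Finset.mem_inter.mpr ⟨hx, hxK⟩⟩, ?_, ?_⟩
  · intro a ha
    rw [Finset.mem_inter] at ha
    refine (h1 a ha.1).trans (Finset.card_le_card fun b hb => ?_)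
    simp only [Finset.mem_filter, Finset.mem_inter] at hb ⊢
    exact ⟨⟨hb.1, hcl a ha.2 b (hY (hB hb.1)) hb.2⟩, hb.2⟩
  · intro a ha
    rw [Finset.mem_inter] at ha
    refine (h2 a ha.1).trans (Finset.card_le_card fun b hb => ?_)
    simp only [Finset.mem_filter, Finset.mem_inter] at hb ⊢
    exact ⟨⟨hb.1, hcl a ha.2 b (hX (hA hb.1)) hb.2⟩, hb.2⟩

theorem HasCore.erase {d : ℕ} {X Y : Finset V} (hd : 0 < d) (h : G.HasCore (d + 1) X Y) (v : V) :
    G.HasCore d (X.erase v) (Y.erase v) := by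
  obtain ⟨A, hA, B, hB, ⟨x, hx⟩, h1, h2⟩ := h
  have key : ∀ (T : Finset V) (a : V), d + 1 ≤ (T.filter (G.Adj a)).card →
      d ≤ ((T.erase v).filter (G.Adj a)).card := by
    intro T a h
    rw [Finset.filter_erase]
    have := Finset.pred_card_le_card_erase (s := T.filter (G.Adj a)) (a := v)
    omega
  refine ⟨A.erase v, Finset.erase_subset_erase v hA, B.erase v, Finset.erase_subset_erase v hB,
    ?_, fun a ha => key B a (h1 a (Finset.mem_of_mem_erase ha)),
    fun a ha => key A a (h2 a (Finset.mem_of_mem_erase ha))⟩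
  have h3 := h1 x hx
  obtain ⟨y, hy⟩ := Finset.card_pos.mp ((Nat.succ_pos d).trans_le h3)
  have h4 := key A y (h2 y (Finset.mem_filter.mp hy).1)
  obtain ⟨z, hz⟩ := Finset.card_pos.mp (hd.trans_le h4)
  exact ⟨z, (Finset.mem_filter.mp hz).1⟩

/-- The pairs in `X × Y` fall into those whose first entry satisfies `P`, those whose second entry
does, and those for which neither does. -/
theorem EdgesSplit.of_filter {d₁ d₂ d₃ : ℕ} {X Y : Finset V} (P : V → Prop)
    (h₁ : G.EdgesSplit d₁ (X.filter P) Y) (h₂ : G.EdgesSplit d₂ X (Y.filter P))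
    (h₃ : G.EdgesSplit d₃ (X.filter fun a => ¬ P a) (Y.filter fun a => ¬ P a)) :
    G.EdgesSplit (d₁ + d₂ + d₃) X Y := by
  obtain ⟨F₁, h11, h12⟩ := h₁
  obtain ⟨F₂, h21, h22⟩ := h₂
  obtain ⟨F₃, h31, h32⟩ := h₃
  refine ⟨fun a b => (P a ∧ F₁ a b) ∨ (¬ P a ∧ P b ∧ F₂ a b) ∨ (¬ P a ∧ ¬ P b ∧ F₃ a b),
    fun a ha => ?_, fun b hb => ?_⟩
  · by_cases hPa : P a
    · refine (Finset.card_le_card fun b hb => ?_).trans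
        ((h11 a (Finset.mem_filter.mpr ⟨ha, hPa⟩)).trans (by omega))
      simp only [Finset.mem_filter] at hb ⊢
      tauto
    · have b2 := h21 a ha
      have b3 := h31 a (Finset.mem_filter.mpr ⟨ha, hPa⟩)
      refine (Finset.card_le_card fun b hb => ?_).trans
        ((Finset.card_union_le _ _).trans ((Nat.add_le_add b2 b3).trans (by omega)))
      simp only [Finset.mem_filter, Finset.mem_union] at hb ⊢
      tauto
  · have b1 := h12 b hb
    by_cases hPb : P b
    · have b2 := h22 b (Finset.mem_filter.mpr ⟨hb, hPb⟩)
      refine (Finset.card_le_card fun a ha => ?_).trans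
        ((Finset.card_union_le _ _).trans ((Nat.add_le_add b1 b2).trans (by omega)))
      simp only [Finset.mem_filter, Finset.mem_union] at ha ⊢
      tauto
    · have b3 := h32 b (Finset.mem_filter.mpr ⟨hb, hPb⟩)
      refine (Finset.card_le_card fun a ha => ?_).trans
        ((Finset.card_union_le _ _).trans ((Nat.add_le_add b1 b3).trans (by omega)))
      simp only [Finset.mem_filter, Finset.mem_union] at ha ⊢
      tauto

theorem IsInducedPath.cons {N : ℕ} {p : ℕ → V} (hp : G.IsInducedPath (N + 1) p) {v : V}
    (hv : ∀ i < N + 1, v ≠ p i) (hadj : ∀ i < N + 1, (G.Adj v (p i) ↔ i = 0)) :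
    G.IsInducedPath (N + 2) (fun i => Nat.casesOn i v p) := by
  constructor
  · rintro (_ | i) hi (_ | j) hj h
    · rfl
    · exact absurd h (hv j (by omega))
    · exact absurd h.symm (hv i (by omega))
    · exact congrArg _ (hp.inj i (by omega) j (by omega) h)
  · rintro (_ | i) hi (_ | j) hj
    · simp
    · simpa [eq_comm] using hadj j (by omega)
    · simpa [eq_comm, G.adj_comm _ v] using hadj i (by omega)
    · simpa using hp.adj i (by omega) j (by omega)

/-- The induction behind `exists_isInducedPath_of_hasCore`. The vertices in `Z₁` are complete
to `X`, and those in `Z₂` to `Y`, so that neither set can grow to `s` vertices; `t` bounds how many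
more vertices may be recorded. An induced path is grown in a connected set `C` that contains the
core and meets the neighbourhood of the path only in that of its last vertex `v`. Either the core
has a large part without neighbours of `v`, and the path is extended towards it, or there is
a large core one of whose sides consists of neighbours of `v`, and `v` is recorded. -/
theorem exists_isInducedPath_aux (s N t : ℕ) :
    ∃ D, ∀ (V : Type u) (G : SimpleGraph V),
      ¬ (completeBipartiteGraph (Fin s) (Fin s)).IsContained G →
      ∀ X Y Z₁ Z₂ : Finset V, 2 * s ≤ Z₁.card + Z₂.card + t →
        (∀ z ∈ Z₁, ∀ x ∈ X, G.Adj z x) → (∀ z ∈ Z₂, ∀ y ∈ Y, G.Adj z y) →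
        (∀ z ∈ X ∪ Y, z ∉ Z₁ ∧ z ∉ Z₂) → G.HasCore D X Y →
        ∃ p, G.IsInducedPath N p ∧ ∀ i < N, p i ∈ X ∪ Y := by
  induction t with
  | zero =>
    refine ⟨s + 1, fun V G hfree X Y Z₁ Z₂ hcard h1 h2 _ hcore => (hfree ?_).elim⟩
    have hle := hcore.le_card (Nat.succ_pos s)
    rcases le_total s Z₁.card with h | h
    · exact completeBipartiteGraph_isContained_of_card_le h (by omega) h1
    · exact completeBipartiteGraph_isContained_of_card_le (A := Z₂) (B := Y)
        (by omega) (by omega) h2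
  | succ t ih =>
    obtain ⟨D, hD⟩ := ih
    have grow : ∀ n, ∃ E, ∀ (V : Type u) (G : SimpleGraph V),
        ¬ (completeBipartiteGraph (Fin s) (Fin s)).IsContained G →
        ∀ (X Y Z₁ Z₂ C : Finset V) (v : V), 2 * s ≤ Z₁.card + Z₂.card + (t + 1) →
          (∀ z ∈ Z₁, ∀ x ∈ X, G.Adj z x) → (∀ z ∈ Z₂, ∀ y ∈ Y, G.Adj z y) →
          (∀ z ∈ C, z ∉ Z₁ ∧ z ∉ Z₂) → G.ConnectedOn C → v ∈ C → X ⊆ C.erase v → Y ⊆ C.erase v →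
          G.HasCore E X Y →
          (∃ p, G.IsInducedPath N p ∧ ∀ i < N, p i ∈ C) ∨
            ∃ p, G.IsInducedPath (n + 1) p ∧ p 0 = v ∧ ∀ i < n + 1, p i ∈ C := by
      intro n
      induction n with
      | zero =>
        refine ⟨0, fun V G _ X Y Z₁ Z₂ C v _ _ _ _ _ hv _ _ _ =>
          Or.inr ⟨fun _ => v, ⟨by omega, fun i hi j hj => ?_⟩, rfl, fun _ _ => hv⟩⟩
        simp only [SimpleGraph.irrefl, false_iff]
        omega
      | succ n ihn =>
        obtain ⟨E, hE⟩ := ihn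
        refine ⟨2 * (D + D + E) + 1,
          fun V G hfree X Y Z₁ Z₂ C v hcard h1 h2 hZ hC hv hX hY hcore => ?_⟩
        have hXC : X ⊆ C := hX.trans (Finset.erase_subset _ _)
        have hYC : Y ⊆ C := hY.trans (Finset.erase_subset _ _)
        have hvX : v ∉ X := fun h => Finset.notMem_erase v C (hX h)
        have hvY : v ∉ Y := fun h => Finset.notMem_erase v C (hY h)
        obtain ⟨hv1, hv2⟩ := hZ v hv
        -- the vertex `v` is recorded for `X`
        by_cases c1 : G.HasCore (D + 1) (X.filter (G.Adj v)) Y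
        · obtain ⟨p, hp, hpm⟩ := hD V G hfree (X.filter (G.Adj v)) Y (insert v Z₁) Z₂
            (by rw [Finset.card_insert_of_notMem hv1]; omega)
            (by
              intro z hz x hx
              rw [Finset.mem_filter] at hx
              rcases Finset.mem_insert.mp hz with rfl | hz
              · exact hx.2
              · exact h1 z hz x hx.1)
            h2
            (by
              intro z hz
              have hzv : z ≠ v := by rintro rfl; simp [hvX, hvY] at hz
              have hzC : z ∈ C := by
                rcases Finset.mem_union.mp hz with hz | hz
                · exact hXC (Finset.mem_filter.mp hz).1
                · exact hYC hz
              simpa [hzv] using hZ z hzC)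
            (c1.mono (Nat.le_succ _) subset_rfl subset_rfl)
          refine Or.inl ⟨p, hp, fun i hi => ?_⟩
          rcases Finset.mem_union.mp (hpm i hi) with h | h
          · exact hXC (Finset.mem_filter.mp h).1
          · exact hYC h
        -- the vertex `v` is recorded for `Y`
        by_cases c2 : G.HasCore (D + 1) X (Y.filter (G.Adj v))
        · obtain ⟨p, hp, hpm⟩ := hD V G hfree X (Y.filter (G.Adj v)) Z₁ (insert v Z₂)
            (by rw [Finset.card_insert_of_notMem hv2]; omega)
            h1
            (by
              intro z hz x hx
              rw [Finset.mem_filter] at hx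
              rcases Finset.mem_insert.mp hz with rfl | hz
              · exact hx.2
              · exact h2 z hz x hx.1)
            (by
              intro z hz
              have hzv : z ≠ v := by rintro rfl; simp [hvX, hvY] at hz
              have hzC : z ∈ C := by
                rcases Finset.mem_union.mp hz with hz | hz
                · exact hXC hz
                · exact hYC (Finset.mem_filter.mp hz).1
              simpa [hzv] using hZ z hzC)
            (c2.mono (Nat.le_succ _) subset_rfl subset_rfl)
          refine Or.inl ⟨p, hp, fun i hi => ?_⟩
          rcases Finset.mem_union.mp (hpm i hi) with h | h
          · exact hXC h
          · exact hYC (Finset.mem_filter.mp h).1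
        -- the path is extended by a neighbour `b` of `v`
        have c3 : G.HasCore (E + 1) (X.filter fun a => ¬ G.Adj v a)
            (Y.filter fun a => ¬ G.Adj v a) := by
          by_contra c3
          exact (EdgesSplit.of_filter (G.Adj v) (edgesSplit_of_not_hasCore c1)
            (edgesSplit_of_not_hasCore c2) (edgesSplit_of_not_hasCore c3)).not_hasCore hcore
        have sub : ∀ T ⊆ C, v ∉ T → (T.filter fun a => ¬ G.Adj v a) ⊆
            C.filter fun a => a ≠ v ∧ ¬ G.Adj v a := by
          intro T hT hvT a ha
          rw [Finset.mem_filter] at ha ⊢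
          exact ⟨hT ha.1, by rintro rfl; exact hvT ha.1, ha.2⟩
        obtain ⟨K, hKC, hKne, hK, hcl, hKcore⟩ :=
          c3.exists_component (sub X hXC hvX) (sub Y hYC hvY)
        have hKv : ∀ a ∈ K, a ∈ C ∧ a ≠ v ∧ ¬ G.Adj v a := fun a ha =>
          Finset.mem_filter.mp (hKC ha)
        have hKC' : K ⊆ C := fun a ha => (hKv a ha).1
        obtain ⟨a, ha, b, hb, hab⟩ := hC K hKC' hKne
          ⟨v, Finset.mem_sdiff.mpr ⟨hv, fun h => (hKv v h).2.1 rfl⟩⟩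
        rw [Finset.mem_sdiff] at hb
        have hvb : G.Adj v b := by
          by_contra hvb
          have hbv : b ≠ v := by rintro rfl; exact (hKv a ha).2.2 hab.symm
          exact hb.2 (hcl a ha b (Finset.mem_filter.mpr ⟨hb.1, hbv, hvb⟩) hab)
        have hC' : insert b K ⊆ C := Finset.insert_subset hb.1 hKC'
        have herase : (insert b K).erase b = K := Finset.erase_insert hb.2
        rcases hE V G hfree ((X.filter fun a => ¬ G.Adj v a) ∩ K)
          ((Y.filter fun a => ¬ G.Adj v a) ∩ K) Z₁ Z₂ (insert b K) b hcard
          (fun z hz x hx => h1 z hz x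
            (Finset.mem_filter.mp (Finset.mem_inter.mp hx).1).1)
          (fun z hz x hx => h2 z hz x
            (Finset.mem_filter.mp (Finset.mem_inter.mp hx).1).1)
          (fun z hz => hZ z (hC' hz)) (hK.insert ha hab) (Finset.mem_insert_self _ _)
          (by rw [herase]; exact Finset.inter_subset_right)
          (by rw [herase]; exact Finset.inter_subset_right)
          (hKcore.mono (Nat.le_succ _) subset_rfl subset_rfl) with ⟨p, hp, hpm⟩ | ⟨p, hp, hp0, hpm⟩
        · exact Or.inl ⟨p, hp, fun i hi => hC' (hpm i hi)⟩
        · have hpK : ∀ i < n + 1, i ≠ 0 → p i ∈ K := by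
            intro i hi hi0
            rcases Finset.mem_insert.mp (hpm i hi) with h | h
            · exact absurd (hp.inj i hi 0 (by omega) (h.trans hp0.symm)) hi0
            · exact h
          refine Or.inr ⟨_, hp.cons (v := v) ?_ ?_, rfl, ?_⟩
          · intro i hi
            by_cases hi0 : i = 0
            · subst hi0; rw [hp0]; exact hvb.ne
            · exact (hKv _ (hpK i hi hi0)).2.1.symm
          · intro i hi
            by_cases hi0 : i = 0
            · subst hi0; simpa [hp0] using hvb
            · simpa [hi0] using (hKv _ (hpK i hi hi0)).2.2
          · rintro (_ | i) hi
            · exact hv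
            · exact hC' (hpm i (by omega))
    obtain ⟨E, hE⟩ := grow N
    refine ⟨E + 2, fun V G hfree X Y Z₁ Z₂ hcard h1 h2 hZ hcore => ?_⟩
    obtain ⟨K, hKC, ⟨v, hv⟩, hK, hcl, hKcore⟩ := hcore.exists_component
      (Finset.subset_union_left (s₂ := Y)) (Finset.subset_union_right (s₁ := X))
    rcases hE V G hfree ((X ∩ K).erase v) ((Y ∩ K).erase v) Z₁ Z₂ K v hcard
      (fun z hz x hx => h1 z hz x (Finset.mem_inter.mp (Finset.mem_of_mem_erase hx)).1)
      (fun z hz x hx => h2 z hz x (Finset.mem_inter.mp (Finset.mem_of_mem_erase hx)).1)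
      (fun z hz => hZ z (hKC hz)) hK hv
      (Finset.erase_subset_erase v Finset.inter_subset_right)
      (Finset.erase_subset_erase v Finset.inter_subset_right)
      ((hKcore.erase (Nat.succ_pos E) v).mono (Nat.le_succ _) subset_rfl subset_rfl)
      with ⟨p, hp, hpm⟩ | ⟨p, hp, _, hpm⟩
    · exact ⟨p, hp, fun i hi => hKC (hpm i hi)⟩
    · exact ⟨p, ⟨fun i hi j hj => hp.inj i (by omega) j (by omega),
        fun i hi j hj => hp.adj i (by omega) j (by omega)⟩, fun i hi => hKC (hpm i (by omega))⟩

/-- Graphs of large minimum degree without `K_{s,s}` contain long induced paths. -/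
theorem exists_isInducedPath_of_hasCore (s N : ℕ) :
    ∃ D, ∀ (V : Type u) (G : SimpleGraph V),
      ¬ (completeBipartiteGraph (Fin s) (Fin s)).IsContained G →
      ∀ S : Finset V, G.HasCore D S S → ∃ p, G.IsInducedPath N p ∧ ∀ i < N, p i ∈ S := by
  obtain ⟨D, hD⟩ := exists_isInducedPath_aux.{u} s N (2 * s)
  refine ⟨D, fun V G hfree S hS => ?_⟩
  simpa using hD V G hfree S S ∅ ∅ (by simp) (by simp) (by simp) (by simp) hS

end InducedPaths

/-! ### Breadth-first search layers -/

section Layers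

variable {V : Type u} {G : SimpleGraph V}

/-- Distances from `r` inside a connected set `C`. -/
theorem ConnectedOn.exists_layering {C : Finset V} (hC : G.ConnectedOn C) {r : V} (hr : r ∈ C) :
    ∃ f : V → ℕ, (∀ x ∈ C, f x = 0 → x = r) ∧
      (∀ a ∈ C, ∀ b ∈ C, G.Adj a b → f b ≤ f a + 1) ∧
      ∀ x ∈ C, ∀ j, f x = j + 1 → ∃ y ∈ C, f y = j ∧ G.Adj x y := by
  let H : SimpleGraph V :=
    { Adj := fun a b => G.Adj a b ∧ a ∈ C ∧ b ∈ C
      symm := ⟨fun a b h => ⟨h.1.symm, h.2.2, h.2.1⟩⟩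
      loopless := ⟨fun a h => G.loopless.irrefl a h.1⟩ }
  have hH : ∀ {a b}, H.Adj a b ↔ G.Adj a b ∧ a ∈ C ∧ b ∈ C := Iff.rfl
  have hreach : ∀ x ∈ C, H.Reachable r x := by
    by_contra hcon
    push Not at hcon
    obtain ⟨x, hx, hrx⟩ := hcon
    obtain ⟨a, ha, b, hb, hab⟩ := hC (C.filter fun x => H.Reachable r x)
      (Finset.filter_subset _ _) ⟨r, Finset.mem_filter.mpr ⟨hr, Reachable.refl r⟩⟩
      ⟨x, by simp [hx, hrx]⟩
    simp only [Finset.mem_sdiff, Finset.mem_filter, not_and] at ha hb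
    exact hb.2 hb.1 (ha.2.trans (hH.mpr ⟨hab, ha.1, hb.1⟩ : H.Adj a b).reachable)
  have step : ∀ a ∈ C, ∀ b ∈ C, G.Adj a b → H.dist r b ≤ H.dist r a + 1 := by
    intro a ha b hb hab
    obtain ⟨w, hw⟩ := (hreach a ha).exists_walk_length_eq_dist
    have := H.dist_le (w.concat (hH.mpr ⟨hab, ha, hb⟩))
    rwa [Walk.length_concat, hw] at this
  refine ⟨H.dist r, fun x hx h0 => ((hreach x hx).dist_eq_zero_iff.mp h0).symm, step,
    fun x hx j hj => ?_⟩
  obtain ⟨w, hw⟩ := (hreach x hx).exists_walk_length_eq_dist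
  have hnil : ¬ w.Nil := by
    intro h
    rw [Walk.Nil.length_eq_zero h] at hw
    omega
  have hadj := hH.mp (w.adj_penultimate hnil)
  have h1 := H.dist_le w.dropLast
  have h2 := step _ hadj.2.1 x hx hadj.1
  have h3 := w.length_dropLast_add_one hnil
  exact ⟨_, hadj.2.1, by omega, hadj.1.symm⟩

/-- If no layer is dense, and there is no dense pair consisting of a layer and an independent part
of the following one, then the graph is sparse: colour the layers greedily, and let the edges
between consecutive layers be distributed separately for each colour of their upper end. -/
theorem EdgesSplit.of_layers {e : ℕ} {K : Finset V} {f : V → ℕ}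
    (hf : ∀ a ∈ K, ∀ b ∈ K, G.Adj a b → f b ≤ f a + 1)
    (hA : ∀ j, ¬ G.HasCore (e + 1) (K.filter fun v => f v = j) (K.filter fun v => f v = j))
    (hB : ∀ j, ∀ Y ⊆ K.filter fun v => f v = j + 1, (∀ a ∈ Y, ∀ b ∈ Y, ¬ G.Adj a b) →
      ¬ G.HasCore (e + 1) (K.filter fun v => f v = j) Y) :
    G.EdgesSplit (e + (e + 1) * e + e) K K := by
  choose F hF1 hF2 using fun j => edgesSplit_of_not_hasCore (hA j)
  choose c hc using fun j => exists_coloring_of_not_hasCore (hA j)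
  have hB' : ∀ j k, G.EdgesSplit e (K.filter fun v => f v = j)
      ((K.filter fun v => f v = j + 1).filter fun v => c (j + 1) v = k) := by
    intro j k
    refine edgesSplit_of_not_hasCore (hB j _ (Finset.filter_subset _ _) fun a ha b hb hab => ?_)
    rw [Finset.mem_filter] at ha hb
    exact hc (j + 1) a ha.1 b hb.1 hab (ha.2.trans hb.2.symm)
  choose F' hF1' hF2' using hB'
  -- the edges to the next layer that a vertex receives
  have up : ∀ a ∈ K, (Finset.univ.biUnion fun k : Fin (e + 1) =>
      ((K.filter fun v => f v = f a + 1).filter fun v => c (f a + 1) v = k).filter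
        fun b => G.Adj a b ∧ F' (f a) k a b).card ≤ (e + 1) * e := by
    intro a ha
    refine Finset.card_biUnion_le.trans ((Finset.sum_le_card_nsmul _ _ e fun k _ => ?_).trans ?_)
    · exact hF1' (f a) k a (Finset.mem_filter.mpr ⟨ha, rfl⟩)
    · simp
  -- the edges to the previous layer that a vertex receives
  have down : ∀ a ∈ K, ((K.filter fun v => f v + 1 = f a).filter
      fun b => G.Adj a b ∧ ¬ F' (f b) (c (f a) a) b a).card ≤ e := by
    intro a ha
    rcases Nat.eq_zero_or_pos (f a) with h0 | hpos
    · rw [Finset.card_eq_zero.mpr]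
      · exact Nat.zero_le _
      · ext b; simp [h0]
    · obtain ⟨j, hj⟩ : ∃ j, f a = j + 1 := ⟨f a - 1, by omega⟩
      refine (Finset.card_le_card fun b hb => ?_).trans (hF2' j (c (j + 1) a) a
        (Finset.mem_filter.mpr ⟨Finset.mem_filter.mpr ⟨ha, hj⟩, rfl⟩))
      simp only [Finset.mem_filter] at hb ⊢
      have hbj : f b = j := by omega
      rw [hbj, hj] at hb
      exact ⟨⟨hb.1.1, hbj⟩, hb.2⟩
  refine ⟨fun a b => (f b = f a ∧ F (f a) a b) ∨ (f b = f a + 1 ∧ F' (f a) (c (f b) b) a b) ∨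
    (f b + 1 = f a ∧ ¬ F' (f b) (c (f a) a) b a), fun a ha => ?_, fun b hb => ?_⟩
  · refine (Finset.card_le_card (t := _ ∪ _ ∪ _) fun b hb => ?_).trans
      ((Finset.card_union_le _ _).trans (Nat.add_le_add ((Finset.card_union_le _ _).trans
        (Nat.add_le_add (hF1 (f a) a (Finset.mem_filter.mpr ⟨ha, rfl⟩)) (up a ha))) (down a ha)))
    simp only [Finset.mem_filter, Finset.mem_union, Finset.mem_biUnion, Finset.mem_univ,
      true_and] at hb ⊢
    obtain ⟨hbK, hab, ⟨h, hFb⟩ | ⟨h, hFb⟩ | ⟨h, hFb⟩⟩ := hb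
    · exact Or.inl (Or.inl ⟨⟨hbK, h⟩, hab, hFb⟩)
    · exact Or.inl (Or.inr ⟨c (f a + 1) b, ⟨⟨hbK, h⟩, rfl⟩, hab, h ▸ hFb⟩)
    · exact Or.inr ⟨⟨hbK, h⟩, hab, hFb⟩
  · refine (Finset.card_le_card (t := _ ∪ _ ∪ _) fun a ha => ?_).trans
      ((Finset.card_union_le _ _).trans (Nat.add_le_add ((Finset.card_union_le _ _).trans
        (Nat.add_le_add (hF2 (f b) b (Finset.mem_filter.mpr ⟨hb, rfl⟩)) (up b hb))) (down b hb)))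
    simp only [Finset.mem_filter, Finset.mem_union, Finset.mem_biUnion, Finset.mem_univ,
      true_and, not_or, not_and, not_not] at ha ⊢
    obtain ⟨haK, hba, h1, h2, h3⟩ := ha
    have l1 := hf a haK b hb hba.symm
    have l2 := hf b hb a haK hba
    have : f b = f a ∨ f b = f a + 1 ∨ f b + 1 = f a := by omega
    rcases this with h | h | h
    · exact Or.inl (Or.inl ⟨⟨haK, h.symm⟩, hba, h ▸ h1 h⟩)
    · exact Or.inr ⟨⟨haK, h.symm⟩, hba, h2 h⟩
    · exact Or.inl (Or.inr ⟨c (f b + 1) a, ⟨⟨haK, h.symm⟩, rfl⟩, hba, by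
        have := h3 h
        rwa [← h] at this⟩)

/-- A dense set `S` contains a dense set `S'` of the following kind. It lies, apart from an
independent set `S' \ T`, in a single layer of a breadth-first search; the vertices in `T` have
neighbours in the previous layer `R`, and the vertices of `R` are connected to one another
through the earlier layers `H`, which send no edges to `S'`. -/
theorem exists_dense_layer (d : ℕ) :
    ∃ D, ∀ (V : Type u) (G : SimpleGraph V) (S : Finset V), G.HasCore D S S →
      ∃ S' T R H : Finset V, S' ⊆ S ∧ R ⊆ S ∧ Disjoint R S' ∧ G.HasCore d S' S' ∧
        (∀ a ∈ T, ∃ u ∈ R, G.Adj u a) ∧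
        (∀ a ∈ S', ∀ b ∈ S', a ∉ T → b ∉ T → ¬ G.Adj a b) ∧
        (∀ u ∈ R, ∀ w ∈ R, ∃ q : G.Walk u w, ∀ v ∈ q.support, v = u ∨ v = w ∨ v ∈ H) ∧
        ∀ h ∈ H, h ∉ S' ∧ ∀ a ∈ S', ¬ G.Adj a h := by
  refine ⟨2 * ((d + 1) + (d + 1 + 1) * (d + 1) + (d + 1)) + 1, fun V G S hS => ?_⟩
  obtain ⟨K, hKS, ⟨r, hr⟩, hK, -, hcore⟩ := hS.exists_component subset_rfl subset_rfl
  replace hcore := hcore.mono le_rfl Finset.inter_subset_right Finset.inter_subset_right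
  obtain ⟨f, hf0, hf1, hf2⟩ := hK.exists_layering hr
  have hub : ∀ n, ∀ u ∈ K, f u = n →
      ∃ q : G.Walk u r, ∀ v ∈ q.support, v = u ∨ v ∈ K.filter fun v => f v < n := by
    intro n
    induction n with
    | zero =>
      intro u hu h0
      obtain rfl := hf0 u hu h0
      exact ⟨Walk.nil, by simp⟩
    | succ n ih =>
      intro u hu hn
      obtain ⟨y, hy, hyn, huy⟩ := hf2 u hu n hn
      obtain ⟨q, hq⟩ := ih y hy hyn
      refine ⟨Walk.cons huy q, fun v hv => ?_⟩
      rw [Walk.support_cons, List.mem_cons] at hv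
      rcases hv with hv | hv
      · exact Or.inl hv
      · right
        rcases hq v hv with rfl | h
        · exact Finset.mem_filter.mpr ⟨hy, by omega⟩
        · rw [Finset.mem_filter] at h ⊢
          exact ⟨h.1, by omega⟩
  have layer0 : (K.filter fun v => f v = 0).card ≤ 1 := by
    refine Finset.card_le_one.mpr fun a ha b hb => ?_
    rw [Finset.mem_filter] at ha hb
    exact (hf0 a ha.1 ha.2).trans (hf0 b hb.1 hb.2).symm
  -- the parents of a layer with number `j + 1`, and the layers above them
  have finish : ∀ j, ∀ S' ⊆ K, (∀ v ∈ S', j + 1 ≤ f v) → G.HasCore d S' S' →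
      (∀ a ∈ S', ∀ b ∈ S', f a ≠ j + 1 → f b ≠ j + 1 → ¬ G.Adj a b) →
      ∃ S' T R H : Finset V, S' ⊆ S ∧ R ⊆ S ∧ Disjoint R S' ∧ G.HasCore d S' S' ∧
        (∀ a ∈ T, ∃ u ∈ R, G.Adj u a) ∧
        (∀ a ∈ S', ∀ b ∈ S', a ∉ T → b ∉ T → ¬ G.Adj a b) ∧
        (∀ u ∈ R, ∀ w ∈ R, ∃ q : G.Walk u w, ∀ v ∈ q.support, v = u ∨ v = w ∨ v ∈ H) ∧
        ∀ h ∈ H, h ∉ S' ∧ ∀ a ∈ S', ¬ G.Adj a h := by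
    intro j S' hS'K hlow hS' hstab
    refine ⟨S', K.filter fun v => f v = j + 1, K.filter fun v => f v = j,
      K.filter fun v => f v < j, hS'K.trans hKS, (Finset.filter_subset _ _).trans hKS, ?_, hS',
      ?_, ?_, ?_, ?_⟩
    · refine Finset.disjoint_left.mpr fun v hv hvS => ?_
      have := hlow v hvS
      have := (Finset.mem_filter.mp hv).2
      omega
    · intro a ha
      rw [Finset.mem_filter] at ha
      obtain ⟨y, hy, hyj, hay⟩ := hf2 a ha.1 j ha.2
      exact ⟨y, Finset.mem_filter.mpr ⟨hy, hyj⟩, hay.symm⟩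
    · intro a ha b hb haT hbT
      exact hstab a ha b hb (fun h => haT (Finset.mem_filter.mpr ⟨hS'K ha, h⟩))
        (fun h => hbT (Finset.mem_filter.mpr ⟨hS'K hb, h⟩))
    · intro u hu w hw
      rw [Finset.mem_filter] at hu hw
      obtain ⟨q, hq⟩ := hub j u hu.1 hu.2
      obtain ⟨q', hq'⟩ := hub j w hw.1 hw.2
      refine ⟨q.append q'.reverse, fun v hv => ?_⟩
      rw [Walk.mem_support_append_iff, Walk.support_reverse, List.mem_reverse] at hv
      rcases hv with hv | hv
      · rcases hq v hv with h | h <;> simp only [h, true_or, or_true]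
      · rcases hq' v hv with h | h <;> simp only [h, true_or, or_true]
    · intro h hh
      rw [Finset.mem_filter] at hh
      refine ⟨fun hS => by have := hlow h hS; omega, fun a ha hadj => ?_⟩
      have h1 := hf1 h hh.1 a (hS'K ha) hadj.symm
      have h2 := hlow a ha
      omega
  by_contra hcon
  refine (EdgesSplit.of_layers (e := d + 1) hf1 (fun j hj => ?_)
    fun j Y hY hstab hj => ?_).not_hasCore hcore
  · rcases j with _ | j
    · have := hj.le_card (Nat.succ_pos _)
      omega
    · refine hcon (finish j _ (Finset.filter_subset _ _) (fun v hv => ?_)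
        (hj.mono (by omega) subset_rfl subset_rfl) fun a ha b _ hja _ => ?_)
      · exact (Finset.mem_filter.mp hv).2.ge
      · exact absurd (Finset.mem_filter.mp ha).2 hja
  · have hYK : ∀ v ∈ Y, v ∈ K ∧ f v = j + 1 := fun v hv => Finset.mem_filter.mp (hY hv)
    rcases j with _ | j
    · have := hj.le_card (Nat.succ_pos _)
      omega
    · refine hcon (finish j _ (Finset.union_subset (Finset.filter_subset _ _)
        fun v hv => (hYK v hv).1) (fun v hv => ?_)
        (hj.union.mono (by omega) subset_rfl subset_rfl) fun a ha b hb hja hjb => ?_)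
      · rcases Finset.mem_union.mp hv with hv | hv
        · exact (Finset.mem_filter.mp hv).2.ge
        · have := (hYK v hv).2
          omega
      · have side : ∀ x ∈ (K.filter fun v => f v = j + 1) ∪ Y, f x ≠ j + 1 → x ∈ Y := by
          intro x hx hxj
          rcases Finset.mem_union.mp hx with hx | hx
          · exact absurd (Finset.mem_filter.mp hx).2 hxj
          · exact hx
        exact hstab a (side a ha hja) b (side b hb hjb)

end Layers

/-! ### Dense graphs without long chordless cycles -/

section DenseGraphs

variable {V : Type u} {G : SimpleGraph V}

theorem IsInducedPath.exists_walk {M : ℕ} {p : ℕ → V} (hp : G.IsInducedPath M p) (i n : ℕ)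
    (hn : i + n < M) :
    ∃ w : G.Walk (p i) (p (i + n)), ∀ v ∈ w.support, ∃ t, i ≤ t ∧ t ≤ i + n ∧ v = p t := by
  induction n with
  | zero => exact ⟨Walk.nil, fun v hv => ⟨i, le_rfl, le_rfl, by simpa using hv⟩⟩
  | succ n ih =>
    obtain ⟨w, hw⟩ := ih (by omega)
    refine ⟨w.concat ((hp.adj _ (by omega) _ hn).mpr (Or.inl rfl)), fun v hv => ?_⟩
    rw [Walk.support_concat, List.mem_append, List.mem_singleton] at hv
    rcases hv with hv | rfl
    · obtain ⟨t, h1, h2, h3⟩ := hw v hv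
      exact ⟨t, h1, by omega, h3⟩
    · exact ⟨i + (n + 1), by omega, le_rfl, rfl⟩

theorem IsInducedPath.shift {M m a : ℕ} {p : ℕ → V} (hp : G.IsInducedPath M p) (h : a + m ≤ M) :
    G.IsInducedPath m fun i => p (a + i) := by
  refine ⟨fun i hi j hj hij => ?_, fun i hi j hj => ?_⟩
  · have := hp.inj _ (by omega) _ (by omega) hij
    omega
  · rw [hp.adj _ (by omega) _ (by omega)]
    omega

/-- Two vertices `u` and `w` that are connected off an induced path leave no long gap on it between
a neighbour of `u` and a neighbour of `w`, since such a gap closes up to a chordless cycle. The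
case `u = w` is included. -/
theorem IsInducedPath.gap_le {ℓ M : ℕ} (hG : G.IsEllChordal ℓ) {p : ℕ → V}
    (hp : G.IsInducedPath M p) {H : Finset V} {u w : V} (q : G.Walk u w)
    (hq : ∀ v ∈ q.support, v = u ∨ v = w ∨ v ∈ H)
    (hH : ∀ h ∈ H, ∀ t < M, h ≠ p t ∧ ¬ G.Adj (p t) h)
    (hu : ∀ t < M, u ≠ p t) (hw : ∀ t < M, w ≠ p t) {i j : ℕ} (hij : i < j) (hj : j < M)
    (hui : G.Adj u (p i)) (hwj : G.Adj w (p j))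
    (hgap : ∀ t, i < t → t < j → ¬ G.Adj u (p t) ∧ ¬ G.Adj w (p t)) : j ≤ i + (ℓ + 1) := by
  by_contra hlt
  have hne : p i ≠ p j := fun h => by
    have := hp.inj i (by omega) j hj h
    omega
  have hnadj : ¬ G.Adj (p i) (p j) := by
    rw [hp.adj i (by omega) j hj]
    omega
  obtain ⟨n, rfl⟩ : ∃ n, j = i + n := ⟨j - i, by omega⟩
  obtain ⟨a, ha⟩ := hp.exists_walk i n hj
  obtain ⟨b, hb, hlen⟩ := hG.exists_short_walk hne hnadj
    (A := {v | ∃ t, i < t ∧ t < i + n ∧ v = p t}) (B := {v | v = u ∨ v = w ∨ v ∈ H})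
    (by
      rw [Set.disjoint_left]
      rintro _ ⟨t, h1, h2, rfl⟩ (h | h | h)
      · exact hu t (by omega) h.symm
      · exact hw t (by omega) h.symm
      · exact (hH _ h t (by omega)).1 rfl)
    (by
      rintro _ ⟨t, h1, h2, rfl⟩ b (rfl | rfl | h) hadj
      · exact (hgap t h1 h2).1 hadj.symm
      · exact (hgap t h1 h2).2 hadj.symm
      · exact (hH _ h t (by omega)).2 hadj)
    a (by
      intro v hv
      obtain ⟨t, h1, h2, rfl⟩ := ha v hv
      rcases h1.eq_or_lt with rfl | h1
      · exact Or.inl rfl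
      · rcases h2.eq_or_lt with rfl | h2
        · exact Or.inr (Or.inl rfl)
        · exact Or.inr (Or.inr ⟨t, h1, h2, rfl⟩))
    (Walk.cons hui.symm (q.concat hwj)) (by
      intro v hv
      rw [Walk.support_cons, List.mem_cons, Walk.support_concat, List.mem_append,
        List.mem_singleton] at hv
      rcases hv with h | h | h
      · exact Or.inl h
      · exact Or.inr (Or.inr (hq v h))
      · exact Or.inr (Or.inl h))
  -- the position on the path is a Lipschitz function
  have hg : ∀ t < M, sInf {t' | p t' = p t} = t := by
    intro t ht
    have h1 : sInf {t' | p t' = p t} ≤ t := Nat.sInf_le rfl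
    exact hp.inj _ (by omega) _ ht (Nat.sInf_mem (⟨t, rfl⟩ : {t' | p t' = p t}.Nonempty))
  have := Walk.le_add_length_of_lipschitz {v | ∃ t < M, v = p t} (fun v => sInf {t' | p t' = v})
    (by
      rintro _ ⟨t, ht, rfl⟩ _ ⟨t', ht', rfl⟩ hadj
      rw [hp.adj t ht t' ht'] at hadj
      simp only [hg t ht, hg t' ht']
      omega) b
    (by
      intro v hv
      rcases hb v hv with rfl | rfl | ⟨t, h1, h2, rfl⟩
      · exact ⟨i, by omega, rfl⟩
      · exact ⟨i + n, hj, rfl⟩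
      · exact ⟨t, by omega, rfl⟩)
  simp only [hg i (by omega), hg (i + n) hj] at this
  omega

/-- The neighbours of `u` on an induced path meet every window of length `ℓ + 2` between two of
them. -/
theorem IsInducedPath.exists_adj_window {ℓ M : ℕ} (hG : G.IsEllChordal ℓ) {p : ℕ → V}
    (hp : G.IsInducedPath M p) {u : V} (hu : ∀ t < M, u ≠ p t) {i j c : ℕ} (hj : j < M)
    (hui : G.Adj u (p i)) (huj : G.Adj u (p j)) (hic : i ≤ c) (hcj : c + (ℓ + 1) ≤ j) :
    ∃ t, c ≤ t ∧ t ≤ c + (ℓ + 1) ∧ G.Adj u (p t) := by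
  by_contra hcon
  push Not at hcon
  obtain ⟨i', hi', hmax⟩ := Finset.exists_max_image
    ((Finset.range (c + 1)).filter fun t => G.Adj u (p t)) id
    ⟨i, by simp only [Finset.mem_filter, Finset.mem_range]; exact ⟨by omega, hui⟩⟩
  obtain ⟨j', hj', hmin⟩ := Finset.exists_min_image
    ((Finset.range (j + 1)).filter fun t => c ≤ t ∧ G.Adj u (p t)) id
    ⟨j, by simp only [Finset.mem_filter, Finset.mem_range]; exact ⟨by omega, by omega, huj⟩⟩
  simp only [Finset.mem_filter, Finset.mem_range, id] at hi' hmax hj' hmin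
  have h1 : i' < c := by
    by_contra h
    exact hcon i' (by omega) (by omega) hi'.2
  have h2 : c + (ℓ + 1) < j' := by
    by_contra h
    exact hcon j' hj'.2.1 (by omega) hj'.2.2
  have := hp.gap_le hG (H := ∅) (Walk.nil : G.Walk u u) (by simp) (by simp) hu hu
    (i := i') (j := j') (by omega) (by omega) hi'.2 hj'.2.2 (fun t h3 h4 => by
      have : ¬ G.Adj u (p t) := fun h => by
        rcases le_or_gt t c with h5 | h5
        · have := hmax t ⟨by omega, h⟩
          omega
        · have := hmin t ⟨by omega, by omega, h⟩
          omega
      exact ⟨this, this⟩)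
  omega

/-- Suppose that both ends of an induced path are within distance one of a vertex with a neighbour
in `R`, and that any two vertices of `R` are connected off the path. Then some `u ∈ R` has
a neighbour in every short window of a long subpath: the neighbours of the two vertices of `R` found
at the ends leave no long gaps, so one of these vertices has neighbours spread over half the
path. -/
theorem IsInducedPath.exists_frequent_neighbor {ℓ m M : ℕ} (hG : G.IsEllChordal ℓ) {p : ℕ → V}
    (hp : G.IsInducedPath M p) (hM : M = 2 * m + (ℓ + 1) + 2) {R H : Finset V}
    (hconn : ∀ u ∈ R, ∀ w ∈ R, ∃ q : G.Walk u w, ∀ v ∈ q.support, v = u ∨ v = w ∨ v ∈ H)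
    (hH : ∀ h ∈ H, ∀ t < M, h ≠ p t ∧ ¬ G.Adj (p t) h) (hR : ∀ u ∈ R, ∀ t < M, u ≠ p t)
    (hT : ∀ i, i + 1 < M → ∃ u ∈ R, G.Adj u (p i) ∨ G.Adj u (p (i + 1))) :
    ∃ u ∈ R, ∃ a, a + m ≤ M ∧ ∀ c, a ≤ c → c + (ℓ + 1) < a + m →
      ∃ t, c ≤ t ∧ t ≤ c + (ℓ + 1) ∧ G.Adj u (p t) := by
  obtain ⟨u, hu, i₀, hi₀, hui₀⟩ : ∃ u ∈ R, ∃ i ≤ 1, G.Adj u (p i) := by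
    obtain ⟨u, hu, h | h⟩ := hT 0 (by omega)
    · exact ⟨u, hu, 0, by omega, h⟩
    · exact ⟨u, hu, 1, le_rfl, h⟩
  obtain ⟨w, hw, j₀, hj₀, hj₀M, hwj₀⟩ : ∃ w ∈ R, ∃ j, M ≤ j + 2 ∧ j < M ∧ G.Adj w (p j) := by
    obtain ⟨w, hw, h | h⟩ := hT (M - 2) (by omega)
    · exact ⟨w, hw, M - 2, by omega, by omega, h⟩
    · exact ⟨w, hw, M - 2 + 1, by omega, by omega, h⟩
  by_cases hfar : ∃ i, m + 1 ≤ i ∧ i < M ∧ G.Adj u (p i)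
  · obtain ⟨i, hmi, hi, hui⟩ := hfar
    exact ⟨u, hu, 1, by omega, fun c h1 h2 =>
      hp.exists_adj_window hG (hR u hu) hi hui₀ hui (by omega) (by omega)⟩
  push Not at hfar
  obtain ⟨b, hb, hmax⟩ := Finset.exists_max_image
    ((Finset.range M).filter fun t => G.Adj u (p t)) id
    ⟨i₀, by simp only [Finset.mem_filter, Finset.mem_range]; exact ⟨by omega, hui₀⟩⟩
  simp only [Finset.mem_filter, Finset.mem_range, id] at hb hmax
  have hbm : b ≤ m := by
    by_contra h
    exact hfar b (by omega) hb.1 hb.2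
  obtain ⟨a', ha', hmin⟩ := Finset.exists_min_image
    ((Finset.range M).filter fun t => b < t ∧ G.Adj w (p t)) id
    ⟨j₀, by simp only [Finset.mem_filter, Finset.mem_range]; exact ⟨by omega, by omega, hwj₀⟩⟩
  simp only [Finset.mem_filter, Finset.mem_range, id] at ha' hmin
  obtain ⟨q, hq⟩ := hconn u hu w hw
  have hgap := hp.gap_le hG q hq hH (hR u hu) (hR w hw) (i := b) (j := a') ha'.2.1 ha'.1 hb.2
    ha'.2.2 fun t h1 h2 =>
      ⟨fun h => by have := hmax t ⟨by omega, h⟩; omega,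
        fun h => by have := hmin t ⟨by omega, h1, h⟩; omega⟩
  exact ⟨w, hw, m + (ℓ + 1), by omega, fun c h1 h2 =>
    hp.exists_adj_window hG (hR w hw) hj₀M ha'.2.2 hwj₀ (by omega) (by omega)⟩

/-- Passing to a dense layer and then finding an induced path in it yields one more vertex with
frequent neighbours on the path. -/
theorem exists_isInducedPath_frequent (ℓ s k : ℕ) : ∀ m, ∃ D, ∀ (V : Type u) (G : SimpleGraph V),
    G.IsEllChordal ℓ → ¬ (completeBipartiteGraph (Fin s) (Fin s)).IsContained G →
    ∀ S : Finset V, G.HasCore D S S → ∃ p, G.IsInducedPath m p ∧ (∀ i < m, p i ∈ S) ∧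
      ∃ U ⊆ S, U.card = k ∧ ∀ u ∈ U, ∀ c, c + (ℓ + 1) < m →
        ∃ t, c ≤ t ∧ t ≤ c + (ℓ + 1) ∧ G.Adj u (p t) := by
  induction k with
  | zero =>
    intro m
    obtain ⟨D, hD⟩ := exists_isInducedPath_of_hasCore.{u} s m
    refine ⟨D, fun V G _ hfree S hS => ?_⟩
    obtain ⟨p, hp, hpS⟩ := hD V G hfree S hS
    exact ⟨p, hp, hpS, ∅, by simp, by simp, by simp⟩
  | succ k ih =>
    intro m
    obtain ⟨D, hD⟩ := ih (2 * m + (ℓ + 1) + 2)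
    obtain ⟨D', hD'⟩ := exists_dense_layer.{u} D
    refine ⟨D', fun V G hG hfree S hS => ?_⟩
    obtain ⟨S', T, R, H, hS'S, hRS, hRS', hS', hT, hstab, hconn, hH⟩ := hD' V G S hS
    obtain ⟨p, hp, hpS', U, hU, hUk, hfreq⟩ := hD V G hG hfree S' hS'
    obtain ⟨u, hu, a, ha, hau⟩ := hp.exists_frequent_neighbor hG rfl hconn
      (fun h hh t ht => ⟨fun he => (hH h hh).1 (he ▸ hpS' t ht), (hH h hh).2 _ (hpS' t ht)⟩)
      (fun u hu t ht he => Finset.disjoint_left.mp hRS' hu (he ▸ hpS' t ht))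
      (fun i hi => by
        by_cases h1 : p i ∈ T
        · obtain ⟨u, hu, h⟩ := hT _ h1
          exact ⟨u, hu, Or.inl h⟩
        by_cases h2 : p (i + 1) ∈ T
        · obtain ⟨u, hu, h⟩ := hT _ h2
          exact ⟨u, hu, Or.inr h⟩
        exact absurd ((hp.adj i (by omega) (i + 1) hi).mpr (Or.inl rfl))
          (hstab _ (hpS' i (by omega)) _ (hpS' _ hi) h1 h2))
    refine ⟨_, hp.shift ha, fun i hi => hS'S (hpS' _ (by omega)), insert u U,
      Finset.insert_subset (hRS hu) (hU.trans hS'S), ?_, ?_⟩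
    · rw [Finset.card_insert_of_notMem fun h => Finset.disjoint_left.mp hRS' hu (hU h), hUk]
    · intro v hv c hc
      obtain ⟨t, h1, h2, h3⟩ : ∃ t, a + c ≤ t ∧ t ≤ a + c + (ℓ + 1) ∧ G.Adj v (p t) := by
        rcases Finset.mem_insert.mp hv with rfl | hv
        · exact hau (a + c) (by omega) (by omega)
        · exact hfreq v hv (a + c) (by omega)
      exact ⟨t - a, by omega, by omega, by rwa [Nat.add_sub_cancel' (by omega)]⟩

/-- **Kühn and Osthus**, for long cycles: an `ℓ`-chordal graph without `K_{s,s}` has bounded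
degeneracy. Many vertices with frequent neighbours on a common induced path contain the sides of
a `K_{s,s}` by the pigeonhole principle. -/
theorem exists_not_hasCore (ℓ s : ℕ) : ∃ D, ∀ (V : Type u) (G : SimpleGraph V),
    G.IsEllChordal ℓ → ¬ (completeBipartiteGraph (Fin s) (Fin s)).IsContained G →
    ∀ S : Finset V, ¬ G.HasCore D S S := by
  obtain ⟨D, hD⟩ := exists_isInducedPath_frequent.{u} ℓ s ((ℓ + 2) * s)
    ((ℓ + 2) ^ ((ℓ + 2) * s) * s * (ℓ + 2))
  refine ⟨D, fun V G hG hfree S hS => hfree ?_⟩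
  obtain ⟨p, hp, -, U, -, hUk, hfreq⟩ := hD V G hG hfree S hS
  set Q := (ℓ + 2) ^ ((ℓ + 2) * s) * s with hQ
  have hblock : ∀ (t : Fin Q) (r : ℕ), r < ℓ + 2 → (t : ℕ) * (ℓ + 2) + r < Q * (ℓ + 2) := by
    intro t r hr
    have : ((t : ℕ) + 1) * (ℓ + 2) ≤ Q * (ℓ + 2) := Nat.mul_le_mul_right _ t.2
    rw [Nat.add_one_mul] at this
    omega
  have hpos : ∀ (t : Fin Q) (u : U), ∃ r : Fin (ℓ + 2), G.Adj u (p (t * (ℓ + 2) + r)) := by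
    intro t u
    obtain ⟨t', h1, h2, h3⟩ := hfreq u u.2 (t * (ℓ + 2)) (hblock t _ (by omega))
    exact ⟨⟨t' - t * (ℓ + 2), by omega⟩, by simpa [Nat.add_sub_cancel' h1] using h3⟩
  choose φ hφ using hpos
  obtain ⟨g, hg⟩ := Fintype.exists_le_card_fiber_of_mul_le_card (n := s) φ (by simp [hUk, hQ])
  obtain ⟨r, hr⟩ := Fintype.exists_le_card_fiber_of_mul_le_card (n := s) g (by simp [hUk])
  refine completeBipartiteGraph_isContained_of_card_le
    (A := (Finset.univ.filter fun u => g u = r).image Subtype.val)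
    (B := (Finset.univ.filter fun t : Fin Q => φ t = g).image fun t : Fin Q =>
      p (t * (ℓ + 2) + r)) ?_ ?_ ?_
  · rwa [Finset.card_image_of_injective _ Subtype.val_injective]
  · rw [Finset.card_image_of_injective]
    · exact hg
    · intro t t' h
      have h1 := hp.inj _ (hblock t _ r.2) _ (hblock t' _ r.2) h
      exact Fin.ext (Nat.eq_of_mul_eq_mul_right (Nat.succ_pos (ℓ + 1)) (Nat.add_right_cancel h1))
  · simp only [Finset.mem_image, Finset.mem_filter, Finset.mem_univ, true_and]
    rintro _ ⟨u, hu, rfl⟩ _ ⟨t, ht, rfl⟩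
    have := hφ t u
    rwa [ht, hu] at this

end DenseGraphs

/-! ### Subdivisions of complete graphs -/

section Subdivisions

/-- If fewer than a `1 / k ^ 3` fraction of all triples are forbidden, then some sequence of length
`k` contains no forbidden triple: by the union bound, a random sequence has this property. -/
theorem exists_avoiding_triples {m k : ℕ} (T : Finset (Fin m × Fin m × Fin m))
    (hT : k ^ 3 * T.card < m ^ 3) :
    ∃ φ : Fin k → Fin m, ∀ i j l, i ≠ j → i ≠ l → j ≠ l → (φ i, φ j, φ l) ∉ T := by
  by_contra hcon
  push Not at hcon
  have hfix : ∀ (i j l : Fin k) (t : Fin m × Fin m × Fin m),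
      m ^ 3 * (Finset.univ.filter fun φ : Fin k → Fin m =>
        i ≠ j ∧ i ≠ l ∧ j ≠ l ∧ (φ i, φ j, φ l) = t).card ≤ m ^ k := by
    intro i j l t
    have h := Finset.card_le_card_of_injOn (s := (Finset.univ : Finset (Fin m × Fin m × Fin m)) ×ˢ
        Finset.univ.filter fun φ : Fin k → Fin m =>
          i ≠ j ∧ i ≠ l ∧ j ≠ l ∧ (φ i, φ j, φ l) = t) (t := Finset.univ)
      (fun x => Function.update (Function.update (Function.update x.2 i x.1.1) j x.1.2.1) l x.1.2.2)
      (by simp) (by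
        rintro ⟨⟨a, b, c⟩, φ⟩ h1 ⟨⟨a', b', c'⟩, φ'⟩ h2 h
        simp only [Finset.coe_product, Finset.coe_univ, Finset.coe_filter, Finset.mem_univ,
          true_and, Set.mem_prod, Set.mem_univ, Set.mem_ofPred_eq] at h1 h2
        obtain ⟨hij, hil, hjl, rfl⟩ := h1
        obtain ⟨-, -, -, ht⟩ := h2
        simp only [Prod.mk.injEq] at ht
        have e : ∀ x, _ = _ := fun x => congrFun h x
        have ei := e i
        have ej := e j
        have el := e l
        simp only [Function.update_self, Function.update_of_ne hij, Function.update_of_ne hil,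
          Function.update_of_ne hjl] at ei ej el
        subst ei ej el
        simp only [Prod.mk.injEq, true_and]
        funext x
        have ex := e x
        by_cases hxl : x = l
        · subst hxl; exact ht.2.2.symm
        by_cases hxj : x = j
        · subst hxj; exact ht.2.1.symm
        by_cases hxi : x = i
        · subst hxi; exact ht.1.symm
        simpa only [Function.update_of_ne hxl, Function.update_of_ne hxj,
          Function.update_of_ne hxi] using ex)
    simp only [Finset.card_product, Finset.card_univ, Fintype.card_prod, Fintype.card_fin,
      Fintype.card_pi, Finset.prod_const] at h
    calc _ = m * (m * m) * _ := by rw [pow_three]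
      _ ≤ _ := h
  have hcover : (Finset.univ : Finset (Fin k → Fin m)) ⊆
      ((Finset.univ : Finset (Fin k × Fin k × Fin k)) ×ˢ T).biUnion fun y =>
        Finset.univ.filter fun φ : Fin k → Fin m => y.1.1 ≠ y.1.2.1 ∧ y.1.1 ≠ y.1.2.2 ∧
          y.1.2.1 ≠ y.1.2.2 ∧ (φ y.1.1, φ y.1.2.1, φ y.1.2.2) = y.2 := by
    intro φ _
    obtain ⟨i, j, l, hij, hil, hjl, ht⟩ := hcon φ
    simp only [Finset.mem_biUnion, Finset.mem_product, Finset.mem_univ, true_and,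
      Finset.mem_filter]
    exact ⟨((i, j, l), _), ht, hij, hil, hjl, rfl⟩
  have h1 := Nat.mul_le_mul_left (m ^ 3) ((Finset.card_le_card hcover).trans Finset.card_biUnion_le)
  rw [Finset.mul_sum] at h1
  have h2 := h1.trans (Finset.sum_le_card_nsmul _ _ (m ^ k) fun y _ => hfix _ _ _ _)
  simp only [Finset.card_univ, Fintype.card_pi, Finset.prod_const, Fintype.card_fin,
    Finset.card_product, Fintype.card_prod, smul_eq_mul] at h2
  have hm : 0 < m := by
    by_contra h0
    obtain rfl : m = 0 := by omega
    simp at hT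
  have h3 : m ^ 3 ≤ k * (k * k) * T.card := Nat.le_of_mul_le_mul_right h2 (pow_pos hm k)
  rw [pow_three k] at hT
  omega

namespace Subdivision

variable {V : Type u} {G : SimpleGraph V} {m : ℕ}

/-- The ends in `K_m` to which a vertex of the subdivision belongs: a branch vertex `η(x)` has the
single end `x`, and an internal vertex of `P^{xy}` the ends `x` and `y`. -/
noncomputable def ends (S : Subdivision (⊤ : SimpleGraph (Fin m)) G) (a : V) : Finset (Fin m) :=
  Finset.univ.filter fun x => a = S.branch x ∨
    ∃ y, ∃ h : (⊤ : SimpleGraph (Fin m)).Adj x y, a ∈ (S.path h).internalVertices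

/-- The vertices of the subdivision. -/
noncomputable def verts (S : Subdivision (⊤ : SimpleGraph (Fin m)) G) : Finset V :=
  Finset.univ.biUnion fun x => Finset.univ.biUnion fun y =>
    if h : (⊤ : SimpleGraph (Fin m)).Adj x y then (S.path h).support.toFinset else {S.branch x}

variable (S : Subdivision (⊤ : SimpleGraph (Fin m)) G)

theorem ends_branch (x : Fin m) : S.ends (S.branch x) = {x} := by
  ext z
  simp only [ends, Finset.mem_filter, Finset.mem_univ, true_and, Finset.mem_singleton]
  constructor
  · rintro (h | ⟨y, h, hx⟩)
    · exact (S.branch.injective h).symm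
    · exact absurd hx (S.branch_notMem_internal h x)
  · rintro rfl
    exact Or.inl rfl

theorem ends_internal {x y : Fin m} (h : (⊤ : SimpleGraph (Fin m)).Adj x y) {a : V}
    (ha : a ∈ (S.path h).internalVertices) : S.ends a = {x, y} := by
  ext z
  simp only [ends, Finset.mem_filter, Finset.mem_univ, true_and, Finset.mem_insert,
    Finset.mem_singleton]
  constructor
  · rintro (rfl | ⟨w, h', ha'⟩)
    · exact absurd ha (S.branch_notMem_internal h z)
    · by_contra hz
      refine Set.disjoint_left.mp (S.internally_disjoint h h' fun he => hz ?_) ha ha'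
      rw [Sym2.eq_iff] at he
      rcases he with ⟨h1, -⟩ | ⟨-, h1⟩
      · exact Or.inl h1.symm
      · exact Or.inr h1.symm
  · rintro (rfl | rfl)
    · exact Or.inr ⟨y, h, ha⟩
    · refine Or.inr ⟨x, h.symm, ?_⟩
      rw [S.path_symm h]
      exact ⟨by simpa using ha.1, ha.2.2, ha.2.1⟩

theorem card_ends_le (a : V) : (S.ends a).card ≤ 2 := by
  rcases (S.ends a).eq_empty_or_nonempty with h | ⟨x, hx⟩
  · simp [h]
  · rcases (Finset.mem_filter.mp hx).2 with rfl | ⟨y, h, ha⟩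
    · simp [S.ends_branch]
    · rw [S.ends_internal h ha]
      exact Finset.card_le_two

theorem branch_mem_verts (x : Fin m) : S.branch x ∈ S.verts := by
  simp only [verts, Finset.mem_biUnion, Finset.mem_univ, true_and]
  exact ⟨x, x, by simp⟩

theorem internal_mem_verts {x y : Fin m} (h : (⊤ : SimpleGraph (Fin m)).Adj x y) {a : V}
    (ha : a ∈ (S.path h).internalVertices) : a ∈ S.verts := by
  simp only [verts, Finset.mem_biUnion, Finset.mem_univ, true_and]
  refine ⟨x, y, ?_⟩
  rw [dif_pos h]
  exact List.mem_toFinset.mpr ha.1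

theorem card_verts_le {r : ℕ} (hr : ∀ (x y : Fin m) (h : (⊤ : SimpleGraph (Fin m)).Adj x y),
    (S.path h).length ≤ r) : S.verts.card ≤ m * (m * (r + 1)) := by
  have h1 : ∀ x y : Fin m, (if h : (⊤ : SimpleGraph (Fin m)).Adj x y then
      (S.path h).support.toFinset else {S.branch x}).card ≤ r + 1 := by
    intro x y
    split_ifs with h
    · refine (List.toFinset_card_le _).trans ?_
      rw [Walk.length_support]
      exact Nat.succ_le_succ (hr x y h)
    · simp
  have h2 := fun x : Fin m => Finset.card_biUnion_le.trans
    (Finset.sum_le_card_nsmul _ _ _ fun y (_ : y ∈ Finset.univ) => h1 x y)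
  have h3 := Finset.card_biUnion_le.trans
    (Finset.sum_le_card_nsmul _ _ _ fun x (_ : x ∈ Finset.univ) => h2 x)
  simpa [verts] using h3

/-- The triples of vertices of `K_m` that are spoilt by an edge between an internal vertex of
`P^{xy}` and a vertex which belongs to `z`. -/
noncomputable def badTriples : Finset (Fin m × Fin m × Fin m) :=
  S.verts.biUnion fun a => (S.verts.filter (G.Adj a)).biUnion fun b =>
    S.ends a ×ˢ S.ends a ×ˢ S.ends b

/-- An edge spoils at most `2 * 2 * 2` triples in either direction, so a bound on the number of
edges is one on the number of bad triples. -/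
theorem card_badTriples_le {D : ℕ} (h : ¬ G.HasCore D S.verts S.verts) :
    S.badTriples.card ≤ 16 * D * S.verts.card := by
  have h0 := (edgesSplit_of_not_hasCore (d := D)
    fun hc => h (hc.mono (Nat.le_succ _) subset_rfl subset_rfl)).sum_card_le
  have h1 : ∀ a b, (S.ends a ×ˢ S.ends a ×ˢ S.ends b).card ≤ 8 := by
    intro a b
    rw [Finset.card_product, Finset.card_product]
    calc _ ≤ 2 * (2 * 2) := Nat.mul_le_mul (S.card_ends_le a)
          (Nat.mul_le_mul (S.card_ends_le a) (S.card_ends_le b))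
      _ = 8 := rfl
  have h2 := fun a => Finset.card_biUnion_le.trans (Finset.sum_le_card_nsmul _ _ _
    fun b (_ : b ∈ S.verts.filter (G.Adj a)) => h1 a b)
  have h3 := Finset.card_biUnion_le.trans
    (Finset.sum_le_sum fun a (_ : a ∈ S.verts) => h2 a)
  simp only [smul_eq_mul, ← Finset.sum_mul] at h3
  calc S.badTriples.card ≤ _ := h3
    _ ≤ D * (S.verts.card + S.verts.card) * 8 := Nat.mul_le_mul_right _ h0
    _ = 16 * D * S.verts.card := by ring

/-- An `ℓ`-chordal graph has no long sequence of independent branch vertices that contains no bad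
triple: the paths between consecutive ones and the path between the first and the last would give
rise to a long chordless cycle. -/
theorem false_of_forall_notMem_badTriples {ℓ n : ℕ} (hG : G.IsEllChordal ℓ) (hn : ℓ + 2 ≤ n)
    (x : ℕ → Fin m) (hinj : ∀ i ≤ n, ∀ j ≤ n, x i = x j → i = j)
    (hind : ∀ i ≤ n, ∀ j ≤ n, ¬ G.Adj (S.branch (x i)) (S.branch (x j)))
    (hbad : ∀ i ≤ n, ∀ j ≤ n, ∀ l ≤ n, i ≠ j → i ≠ l → j ≠ l →
      (x i, x j, x l) ∉ S.badTriples) : False := by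
  have hadj : ∀ i ≤ n, ∀ j ≤ n, i ≠ j → (⊤ : SimpleGraph (Fin m)).Adj (x i) (x j) :=
    fun i hi j hj hij => fun h => hij (hinj i hi j hj h)
  have hsucc : ∀ i < n, (⊤ : SimpleGraph (Fin m)).Adj (x i) (x (i + 1)) :=
    fun i hi => hadj i hi.le _ hi (by omega)
  have hfar := hadj 0 (Nat.zero_le _) n le_rfl (by omega)
  have hno : ∀ a ∈ S.verts, ∀ b ∈ S.verts, G.Adj a b → ∀ i ≤ n, ∀ j ≤ n, ∀ l ≤ n, i ≠ j →
      x i ∈ S.ends a → x j ∈ S.ends a → x l ∈ S.ends b → l = i ∨ l = j := by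
    intro a ha b hb hab i hi j hj l hl hij h1 h2 h3
    by_contra hcon
    refine hbad i hi j hj l hl hij (by omega) (by omega) ?_
    simp only [badTriples, Finset.mem_biUnion, Finset.mem_filter, Finset.mem_product]
    exact ⟨a, ha, b, ⟨hb, hab⟩, h1, h2, h3⟩
  -- the vertices of the paths between consecutive branch vertices
  let Q : Set V := {v | (∃ i ≤ n, v = S.branch (x i)) ∨
    ∃ i, ∃ hi : i < n, v ∈ (S.path (hsucc i hi)).internalVertices}
  have hQverts : ∀ v ∈ Q, v ∈ S.verts := by
    rintro v (⟨i, hi, rfl⟩ | ⟨i, hi, hv⟩)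
    · exact S.branch_mem_verts _
    · exact S.internal_mem_verts _ hv
  have hwalk : ∀ i ≤ n, ∃ w : G.Walk (S.branch (x 0)) (S.branch (x i)),
      ∀ v ∈ w.support, v ∈ Q := by
    intro i
    induction i with
    | zero => exact fun _ => ⟨Walk.nil, fun v hv => Or.inl ⟨0, Nat.zero_le _, by simpa using hv⟩⟩
    | succ i ih =>
      intro hi
      obtain ⟨w, hw⟩ := ih (by omega)
      refine ⟨w.append (S.path (hsucc i hi)), fun v hv => ?_⟩
      rw [Walk.mem_support_append_iff] at hv
      rcases hv with hv | hv
      · exact hw v hv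
      · by_cases h1 : v = S.branch (x i)
        · exact Or.inl ⟨i, by omega, h1⟩
        by_cases h2 : v = S.branch (x (i + 1))
        · exact Or.inl ⟨i + 1, hi, h2⟩
        exact Or.inr ⟨i, hi, hv, h1, h2⟩
  obtain ⟨w, hw⟩ := hwalk n le_rfl
  -- every vertex of `Q` other than the first and the last one belongs to a branch vertex between
  have hmid : ∀ v ∈ Q, v ≠ S.branch (x 0) → v ≠ S.branch (x n) →
      ∃ l ≤ n, l ≠ 0 ∧ l ≠ n ∧ x l ∈ S.ends v := by
    rintro v (⟨i, hi, rfl⟩ | ⟨i, hi, hv⟩) h0 hn'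
    · refine ⟨i, hi, ?_, ?_, by simp [S.ends_branch]⟩
      · rintro rfl; exact h0 rfl
      · rintro rfl; exact hn' rfl
    · have he := S.ends_internal _ hv
      rcases Nat.eq_zero_or_pos i with rfl | hpos
      · exact ⟨0 + 1, by omega, by omega, by omega, by simp [he]⟩
      · exact ⟨i, by omega, by omega, by omega, by simp [he]⟩
  obtain ⟨b, hb, hlen⟩ := hG.exists_short_walk
    (fun h => hfar (S.branch.injective h)) (hind 0 (Nat.zero_le _) n le_rfl)
    (A := {v | v ∈ Q ∧ v ≠ S.branch (x 0) ∧ v ≠ S.branch (x n)})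
    (B := (S.path hfar).internalVertices)
    (by
      rw [Set.disjoint_left]
      rintro v ⟨hv, h0, hn'⟩ hvB
      obtain ⟨l, hl, hl0, hln, hlv⟩ := hmid v hv h0 hn'
      rw [S.ends_internal hfar hvB, Finset.mem_insert, Finset.mem_singleton] at hlv
      rcases hlv with h | h
      · exact hl0 (hinj l hl 0 (Nat.zero_le _) h)
      · exact hln (hinj l hl n le_rfl h))
    (by
      rintro a ⟨ha, h0, hn'⟩ b hb hab
      obtain ⟨l, hl, hl0, hln, hla⟩ := hmid a ha h0 hn'
      have he := S.ends_internal hfar hb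
      rcases hno b (S.internal_mem_verts hfar hb) a (hQverts a ha) hab.symm 0 (Nat.zero_le _) n
        le_rfl l hl (by omega) (by simp [he]) (by simp [he]) hla with h | h
      · exact hl0 h
      · exact hln h)
    w (by
      intro v hv
      by_cases h1 : v = S.branch (x 0)
      · exact Or.inl h1
      by_cases h2 : v = S.branch (x n)
      · exact Or.inr (Or.inl h2)
      exact Or.inr (Or.inr ⟨hw v hv, h1, h2⟩))
    (S.path hfar) (by
      intro v hv
      by_cases h1 : v = S.branch (x 0)
      · exact Or.inl h1
      by_cases h2 : v = S.branch (x n)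
      · exact Or.inr (Or.inl h2)
      exact Or.inr (Or.inr ⟨hv, h1, h2⟩))
  -- the position along the sequence changes by at most one along each edge in `Q`
  have pos_branch : ∀ i ≤ n, sInf {t | x t ∈ S.ends (S.branch (x i))} = i := by
    intro i hi
    rw [S.ends_branch]
    have h1 : sInf {t | x t ∈ ({x i} : Finset (Fin m))} ≤ i := Nat.sInf_le (by simp)
    have h2 := Nat.sInf_mem (⟨i, by simp⟩ : {t | x t ∈ ({x i} : Finset (Fin m))}.Nonempty)
    rw [Set.mem_ofPred_eq, Finset.mem_singleton] at h2
    exact hinj _ (by omega) i hi h2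
  have pos_internal : ∀ i (hi : i < n), ∀ v ∈ (S.path (hsucc i hi)).internalVertices,
      sInf {t | x t ∈ S.ends v} = i := by
    intro i hi v hv
    have he := S.ends_internal _ hv
    rw [he]
    have h1 : sInf {t | x t ∈ ({x i, x (i + 1)} : Finset (Fin m))} ≤ i := Nat.sInf_le (by simp)
    have h2 := Nat.sInf_mem
      (⟨i, by simp⟩ : {t | x t ∈ ({x i, x (i + 1)} : Finset (Fin m))}.Nonempty)
    rw [Set.mem_ofPred_eq, Finset.mem_insert, Finset.mem_singleton] at h2
    rcases h2 with h2 | h2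
    · exact hinj _ (by omega) i hi.le h2
    · have := hinj _ (by omega) (i + 1) hi h2
      omega
  have hlip := Walk.le_add_length_of_lipschitz Q (fun v => sInf {t | x t ∈ S.ends v})
    (by
      intro a ha b hb hab
      have hab' := hno a (hQverts a ha) b (hQverts b hb) hab
      have hba' := hno b (hQverts b hb) a (hQverts a ha) hab.symm
      rcases ha with ⟨i, hi, rfl⟩ | ⟨i, hi, ha⟩ <;> rcases hb with ⟨j, hj, rfl⟩ | ⟨j, hj, hb⟩
      · exact absurd hab (hind i hi j hj)
      · have he := S.ends_internal _ hb
        have := hba' j hj.le (j + 1) hj i hi (by omega) (by simp [he]) (by simp [he])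
          (by simp [S.ends_branch])
        simp only [pos_branch i hi, pos_internal j hj b hb]
        omega
      · have he := S.ends_internal _ ha
        have := hab' i hi.le (i + 1) hi j hj (by omega) (by simp [he]) (by simp [he])
          (by simp [S.ends_branch])
        simp only [pos_branch j hj, pos_internal i hi a ha]
        omega
      · have he := S.ends_internal _ ha
        have he' := S.ends_internal _ hb
        have := hab' i hi.le (i + 1) hi j hj.le (by omega) (by simp [he]) (by simp [he])
          (by simp [he'])
        simp only [pos_internal j hj b hb, pos_internal i hi a ha]
        omega) b
    (by
      intro v hv
      rcases hb v hv with rfl | rfl | h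
      · exact Or.inl ⟨0, Nat.zero_le _, rfl⟩
      · exact Or.inl ⟨n, le_rfl, rfl⟩
      · exact h.1)
  simp only [pos_branch 0 (Nat.zero_le _), pos_branch n le_rfl] at hlip
  omega

end Subdivision

/-- If no subgraph of `G` has minimum degree `D`, then few triples of branch vertices are bad, so
that many branch vertices contain no bad triple, and among these many are independent. -/
theorem not_containsSubdivisionLE {ℓ D : ℕ} {V : Type u} {G : SimpleGraph V}
    (hG : G.IsEllChordal ℓ) (hD : ∀ S : Finset V, ¬ G.HasCore D S S) {m r : ℕ} (hr : 0 < r)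
    (hm : (((D + 1) * (ℓ + 3)) ^ 3 * (32 * D + 1) + 1) * r ≤ m) :
    ¬ ContainsSubdivisionLE (⊤ : SimpleGraph (Fin m)) G r := by
  rintro ⟨S, hS⟩
  set k := (D + 1) * (ℓ + 3) with hk
  have hk3 : 3 ≤ k := by
    rw [hk]
    nlinarith [Nat.zero_le D, Nat.zero_le ℓ]
  have hmpos : 0 < m := by
    have : 0 < (k ^ 3 * (32 * D + 1) + 1) * r := Nat.mul_pos (Nat.succ_pos _) hr
    omega
  -- repeated entries are excluded by declaring the triples `(x, x, z)` forbidden as well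
  obtain ⟨φ, hφ⟩ := exists_avoiding_triples (m := m) (k := k)
    (S.badTriples ∪ (Finset.univ : Finset (Fin m × Fin m)).image fun y => (y.1, y.1, y.2)) (by
      have h1 := S.card_badTriples_le (hD _)
      have h2 := S.card_verts_le hS
      have h3 : ((Finset.univ : Finset (Fin m × Fin m)).image
          fun y => (y.1, y.1, y.2)).card ≤ m * m :=
        Finset.card_image_le.trans (by simp)
      have h4 : 16 * D * S.verts.card ≤ 16 * D * (m * (m * (r + 1))) := Nat.mul_le_mul_left _ h2
      have h5 : r + 1 ≤ 2 * r := by omega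
      have h6 : 16 * D * (m * (m * (r + 1))) ≤ 16 * D * (m * (m * (2 * r))) := by gcongr
      have h7 := (Finset.card_union_le S.badTriples _).trans
        (Nat.add_le_add (h1.trans (h4.trans h6)) h3)
      calc _ ≤ k ^ 3 * (16 * D * (m * (m * (2 * r))) + m * m) := Nat.mul_le_mul_left _ h7
        _ = (k ^ 3 * (32 * D * r + 1)) * m ^ 2 := by ring
        _ ≤ (k ^ 3 * (32 * D + 1) * r) * m ^ 2 := by
            refine Nat.mul_le_mul_right _ ?_
            rw [mul_assoc (k ^ 3)]
            refine Nat.mul_le_mul_left _ ?_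
            rw [Nat.add_one_mul (32 * D)]
            omega
        _ < m * m ^ 2 := by
            refine mul_lt_mul_of_pos_right ?_ (pow_pos hmpos 2)
            rw [Nat.add_one_mul] at hm
            omega
        _ = m ^ 3 := by ring)
  have hφinj : Function.Injective φ := by
    intro i j hij
    by_contra hne
    obtain ⟨l, hl⟩ : ∃ l, l ∉ ({i, j} : Finset (Fin k)) := by
      by_contra hcon
      push Not at hcon
      have := (Finset.card_le_card fun l (_ : l ∈ Finset.univ) => hcon l).trans Finset.card_le_two
      simp at this
      omega
    simp only [Finset.mem_insert, Finset.mem_singleton, not_or] at hl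
    refine hφ i j l hne (Ne.symm hl.1) (Ne.symm hl.2) (Finset.mem_union_right _ ?_)
    simp [hij]
  obtain ⟨c, hc⟩ := exists_coloring_of_not_hasCore (d := D)
    fun h => hD S.verts (h.mono (Nat.le_succ _) subset_rfl subset_rfl)
  obtain ⟨κ, hκ⟩ := Fintype.exists_le_card_fiber_of_mul_le_card (n := ℓ + 3)
    (fun i : Fin k => c (S.branch (φ i))) (by simp [hk])
  obtain ⟨J, hJ, hJcard⟩ := Finset.exists_subset_card_eq hκ
  let e := J.orderEmbOfFin hJcard
  have heJ : ∀ i, c (S.branch (φ (e i))) = κ := fun i =>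
    (Finset.mem_filter.mp (hJ (J.orderEmbOfFin_mem hJcard i))).2
  have hofNat : ∀ i ≤ ℓ + 2, ∀ j ≤ ℓ + 2, Fin.ofNat (ℓ + 3) i = Fin.ofNat (ℓ + 3) j → i = j := by
    intro i hi j hj h
    have := congrArg Fin.val h
    rwa [Fin.val_ofNat, Fin.val_ofNat, Nat.mod_eq_of_lt (by omega),
      Nat.mod_eq_of_lt (by omega)] at this
  have hne : ∀ i ≤ ℓ + 2, ∀ j ≤ ℓ + 2, i ≠ j →
      e (Fin.ofNat (ℓ + 3) i) ≠ e (Fin.ofNat (ℓ + 3) j) :=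
    fun i hi j hj hij h => hij (hofNat i hi j hj (e.injective h))
  refine S.false_of_forall_notMem_badTriples hG le_rfl (fun i => φ (e (Fin.ofNat (ℓ + 3) i)))
    (fun i hi j hj h => hofNat i hi j hj (e.injective (hφinj h)))
    (fun i hi j hj h => ?_) (fun i hi j hj l hl hij hil hjl h => ?_)
  · exact hc _ (S.branch_mem_verts _) _ (S.branch_mem_verts _) h ((heJ _).trans (heJ _).symm)
  · exact hφ _ _ _ (hne i hi j hj hij) (hne i hi l hl hil) (hne j hj l hl hjl)
      (Finset.mem_union_left _ h)

end Subdivisions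

end SimpleGraph

theorem lemma5 (ℓ s : ℕ) :
    ∃ q : ℝ, 0 < q ∧ ∀ m r : ℕ, 0 < m → 0 < r → q * (r : ℝ) ≤ (m : ℝ) →
      ∀ (V : Type*) [Finite V] (G : SimpleGraph V), G.IsEllChordal ℓ →
        SimpleGraph.ContainsSubdivisionLE (⊤ : SimpleGraph (Fin m)) G r →
          (completeBipartiteGraph (Fin s) (Fin s)).IsContained G := by
  obtain ⟨D, hD⟩ := SimpleGraph.exists_not_hasCore ℓ s
  refine ⟨(((D + 1) * (ℓ + 3)) ^ 3 * (32 * D + 1) + 1 : ℕ), by positivity,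
    fun m r _ hr hm V _ G hG hS => ?_⟩
  by_contra hfree
  exact SimpleGraph.not_containsSubdivisionLE hG (hD V G hG hfree) hr (by exact_mod_cast hm) hS
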